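/- Let $\mathcal D$ be the open unit disc in $\mathbb C$, let $\mathbb T$ be the unit circle with Lebesgue measure normalized to have total mass $1$, and let $\mathrm{SU}(1,1)$ be the group of matrices $\left(\begin{smallmatrix} a & b\\ \overline b & \overline a\end{smallmatrix}\right)$ with $a,b\in\mathbb C$, $|a|^2-|b|^2=1$, with the distance $d(X,Y)=\log(1+\|X^{-1}Y-I\|_{\mathrm{op}})$, where $\|\cdot\|_{\mathrm{op}}$ is the operator norm on the Hilbert space $\mathbb C^2$. Let $1\le p<2$ and $p<r\le\infty$, and write $p'=\frac{p}{p-1}$ (so $p'=\infty$ if $p=1$). For $F\in\ell^p(\mathbb Z,\mathcal D)$, $n\in\mathbb Z$ and $z\in\mathbb T$ let $$T_n(z)=(1-|F_n|^2)^{-1/2}\begin{pmatrix} 1 & F_nz^n\\ \overline{F_n}z^{-n} & 1\end{pmatrix},\qquad \gamma[F](N;z)=\prod_{n=-\infty}^N T_n(z)=\lim_{M\to\infty}T_{-M}(z)T_{-M+1}(z)\cdots T_N(z)\quad(N\in\mathbb Z).$$ For almost every $z\in\mathbb T$, these limits exist for all $N\in\mathbb Z$ and lie in $\mathrm{SU}(1,1)$.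 For $1\le q<\infty$ define the $q$-variation $$\mathcal V_q(\gamma[F])(z)=\sup_{K}\ \sup_{N_0<\dots<N_K}\Big(\sum_{j=0}^{K-1}d\big(\gamma[F](N_j;z),\gamma[F](N_{j+1};z)\big)^q\Big)^{1/q},$$ the suprema being over all strictly increasing finite sequences of integers, and let $\mathcal V_\infty(\gamma[F])(z)=\sup_{M<N}d(\gamma[F](M;z),\gamma[F](N;z))$. Put $s=r$ if $r<2$ and $s=\frac{p+2}{2}$ if $r\ge 2$, and let $$\mathbb S=\{z\in\mathbb T:\mathcal V_s(\gamma[F])(z)\le 1\}.$$ Then $\mathcal V_r(\gamma[F])$ and $\mathbb S$ are measurable (up to null sets), the sequence $\log\frac{1+|F_n|}{1-|F_n|}$ belongs to $\ell^p(\mathbb Z)$, and there is a constant $C_{p,r}<\infty$, depending only on $p$ and $r$, such that for every $F\in\ell^p(\mathbb Z,\mathcal D)$ $$\|\mathcal V_r(\gamma[F])\|_{L^{p'}(\mathbb S)}+\|\mathcal V_r(\gamma[F])\|_{L^{p'/r}(\mathbb T\setminus\mathbb S)}^{1/r}\le C_{p,r}\,\Big\|\log\Big(\frac{1+|F_n|}{1-|F_n|}\Big)\Big\|_{\ell^p(\mathbb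 Z)}.$$ For $r<\infty$ the second term equals $\|\mathcal V_r(\gamma[F])^{1/r}\|_{L^{p'}(\mathbb T\setminus\mathbb S)}$; for $r=\infty$ it is to be read as the case $1/r=0$ of this expression, that is, as $\|1\|_{L^{p'}(\mathbb T\setminus\mathbb S)}$. -/

import Mathlib

open MeasureTheory Filter Topology
open scoped ENNReal NNReal ComplexConjugate

noncomputable section

namespace NLFT

/-- The Borel `σ`-algebra on the unit circle. -/
instance instMeasurableSpaceCircle : MeasurableSpace Circle := borel Circle

instance instBorelSpaceCircle : BorelSpace Circle := ⟨rfl⟩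

/-- Lebesgue (arc length) measure on the unit circle, normalized to have total mass `1`:
the image of the normalized Haar measure of `ℝ / ℤ` under `t ↦ exp (2 π i t)`. -/
def circleMeasure : Measure Circle :=
  (AddCircle.haarAddCircle (T := (1 : ℝ))).map AddCircle.toCircle

/-- The group `SU(1,1)`, as a set of complex `2 × 2` matrices. -/
def SU11 : Set (Matrix (Fin 2) (Fin 2) ℂ) :=
  {A | ∃ a b : ℂ, ‖a‖ ^ 2 - ‖b‖ ^ 2 = 1 ∧ A = !![a, b; conj b, conj a]}

/-- The operator norm of a `2 × 2` matrix acting on the Hilbert space `ℂ²`. -/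
def opNorm (A : Matrix (Fin 2) (Fin 2) ℂ) : ℝ :=
  ‖Matrix.toEuclideanCLM (n := Fin 2) (𝕜 := ℂ) A‖

/-- The distance `d(X, Y) = log (1 + ‖X⁻¹ Y - I‖)` (for `X`, `Y` in `SU(1,1)`). -/
def dist11 (X Y : Matrix (Fin 2) (Fin 2) ℂ) : ℝ :=
  Real.log (1 + opNorm (X⁻¹ * Y - 1))

/-- The transfer matrix `T_n(z)` of the potential `F`. -/
def transfer (F : ℤ → ℂ) (n : ℤ) (z : Circle) : Matrix (Fin 2) (Fin 2) ℂ :=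
  (((Real.sqrt (1 - ‖F n‖ ^ 2))⁻¹ : ℝ) : ℂ) •
    !![1, F n * (z : ℂ) ^ n; conj (F n) * (z : ℂ) ^ (-n), 1]

/-- The ordered product `T_M(z) T_{M+1}(z) ⋯ T_N(z)` (equal to `I` if `N < M`). -/
def transferProd (F : ℤ → ℂ) (M N : ℤ) (z : Circle) : Matrix (Fin 2) (Fin 2) ℂ :=
  ((List.range (N + 1 - M).toNat).map fun k : ℕ => transfer F (M + (k : ℤ)) z).prod

/-- The nonlinear Fourier transform curve
`γ[F](N; z) = ∏_{n = -∞}^{N} T_n(z) = lim_{M → ∞} T_{-M}(z) ⋯ T_N(z)`. -/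
def curve (F : ℤ → ℂ) (z : Circle) (N : ℤ) : Matrix (Fin 2) (Fin 2) ℂ :=
  limUnder atTop fun M : ℕ => transferProd F (-(M : ℤ)) N z

/-- The `r`-variation, `1 ≤ r ≤ ∞`, of a discrete curve of matrices with respect to `dist11`. -/
def variation (r : ℝ≥0∞) (γ : ℤ → Matrix (Fin 2) (Fin 2) ℂ) : ℝ≥0∞ :=
  if r = ∞ then
    ⨆ (K : ℕ) (N : Fin (K + 1) → ℤ) (_ : StrictMono N) (j : Fin K),
      ENNReal.ofReal (dist11 (γ (N j.castSucc)) (γ (N j.succ)))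
  else
    ⨆ (K : ℕ) (N : Fin (K + 1) → ℤ) (_ : StrictMono N),
      (∑ j : Fin K, ENNReal.ofReal (dist11 (γ (N j.castSucc)) (γ (N j.succ))) ^ r.toReal)
        ^ (1 / r.toReal)

/-- `V_r(γ[F])`, as a function on the unit circle. -/
def curveVar (r : ℝ≥0∞) (F : ℤ → ℂ) (z : Circle) : ℝ≥0∞ :=
  variation r (curve F z)

/-- The exponent `s`: it is `r` if `r < 2`, and `(p + 2) / 2` if `r ≥ 2`. -/
def auxExponent (p r : ℝ≥0∞) : ℝ≥0∞ :=
  if r < 2 then r else (p + 2) / 2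

/-- The set `S = S_{p,r}[F]` of those `z` for which `V_s(γ[F])(z) ≤ 1`. -/
def smallVarSet (p r : ℝ≥0∞) (F : ℤ → ℂ) : Set Circle :=
  {z | curveVar (auxExponent p r) F z ≤ 1}

/-- `F` belongs to `ℓ^p(ℤ, 𝒟)`, where `𝒟` is the open unit disc. -/
def IsPotential (p : ℝ≥0∞) (F : ℤ → ℂ) : Prop :=
  Memℓp (E := fun _ : ℤ => ℂ) F p ∧ ∀ n, ‖F n‖ < 1

/-- The norm of the sequence `log ((1 + |F_n|) / (1 - |F_n|))` in `ℓ^p(ℤ)`. -/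
def logNorm (p : ℝ≥0∞) (F : ℤ → ℂ) : ℝ≥0∞ :=
  eLpNorm (fun n : ℤ => Real.log ((1 + ‖F n‖) / (1 - ‖F n‖))) p Measure.count

end NLFT

end

/-!
The transfer matrix is an exponential, `T_n = exp W_n`, where `W_n` is off-diagonal and Hermitian
with upper right entry `f_n z ^ n`, and
`|f_n| = artanh |F_n| = (1 / 2) log ((1 + |F_n|) / (1 - |F_n|))`.
So `γ[F]` is the multiplicative counterpart of the partial sums of the Fourier series with
coefficients `f_n`, and everything follows from two facts about an exponent `s` with `p < s < 2`.

* *Linear estimate.* At each `z` the increments of the partial sums over intervals inside `[-n, n)`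
  satisfy `|S(a, b)| ^ s ≤ ω(a, b)` for a superadditive function `ω` of the interval ("control",
  `IsControl`), whose total mass to the power `1 / s` has `L^{p'}` norm `≲ ‖f‖_p`. This is a
  variational Christ–Kiselev argument (`exists_dominating_control`): `ω(a, b)` is a weighted sum of
  `|S_J| ^ s` over the intervals `J ⊆ [a, b)` of a binary tree adapted to `∑ |f_n| ^ p`. The
  estimate for a single interval is the Hausdorff–Young inequality, obtained here by interpolation between
  `L^1 → L^∞` and `L²` (`exists_eLpNorm_trigSum_le`).
* *Nonlinear estimate.* Since `s < 2`, a control of the increments of the linear sums also controls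
  the ordered products (`exists_log_one_add_norm_sub_one_le`, a discrete version of a theorem of
  Lyons): `d ≤ C (ω ^ (1 / s) + ω)`. For small `ω` this is a bisection argument
  (`exists_norm_sub_one_sub_le`), and for large `ω` the interval is cut into `≲ ω` pieces.

Together, and with Fatou's lemma to pass to all of `ℤ`, they give `V_s(γ[F]) ≤ C (U + U ^ s)`
pointwise with `‖U‖_{L^{p'}} ≲ ‖f‖_p` (`exists_logDist_majorant`). In particular `U` is finite
almost everywhere, so the variation is finite and the products converge. On the set where `V_s ≤ 1` this
gives `V_r ≤ V_s ≲ U`, and off this set `U ≳ 1` and `V_r ≤ V_s ≤ (2 C U) ^ s ≤ (2 C U) ^ r`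
(`le_or_le_rpow_of_le_add_rpow`), which are the two terms of the inequality.
-/

namespace NLFT

/-! ### Control functions on integer intervals -/

/-- A control: a nonnegative function of the half-open integer intervals `[a, b)` which is
superadditive under concatenation of intervals. -/
structure IsControl (ω : ℤ → ℤ → ℝ) : Prop where
  nonneg : ∀ a b, 0 ≤ ω a b
  superadd : ∀ a b c, a ≤ b → b ≤ c → ω a b + ω b c ≤ ω a c

namespace IsControl

variable {ω : ℤ → ℤ → ℝ}

theorem self_eq_zero (h : IsControl ω) (a : ℤ) : ω a a = 0 := by
  have h1 := h.superadd a a a le_rfl le_rfl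
  have h2 := h.nonneg a a
  linarith

theorem mono (h : IsControl ω) {a b c d : ℤ} (hab : a ≤ b) (hbc : b ≤ c) (hcd : c ≤ d) :
    ω b c ≤ ω a d := by
  have h1 := h.superadd a b c hab hbc
  have h2 := h.superadd a c d (hab.trans hbc) hcd
  have h3 := h.nonneg a b
  have h4 := h.nonneg c d
  linarith

/-- The longest initial piece `[a, c)` on which the control is at most `θ`; the piece which is one
step longer exceeds `θ`, unless it would leave the interval. -/
theorem exists_longest (h : IsControl ω) {θ : ℝ} (hθ : 0 ≤ θ) {a b : ℤ} (hab : a < b) :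
    ∃ c, a ≤ c ∧ c < b ∧ ω a c ≤ θ ∧ (c + 1 < b → θ < ω a (c + 1)) := by
  obtain ⟨c, ⟨h1, h2, h3⟩, h4⟩ := Int.exists_greatest_of_bdd
    (P := fun c => a ≤ c ∧ c < b ∧ ω a c ≤ θ) ⟨b, fun z hz => hz.2.1.le⟩
    ⟨a, le_rfl, hab, by rw [h.self_eq_zero]; exact hθ⟩
  refine ⟨c, h1, h2, h3, fun h5 => ?_⟩
  by_contra! h6
  have := h4 (c + 1) ⟨by omega, h5, h6⟩
  omega

/-- An interval splits into a piece, a single point and a piece, such that each of the two pieces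
carries at most half of the control. -/
theorem exists_split (h : IsControl ω) {a b : ℤ} (hab : a < b) :
    ∃ c, a ≤ c ∧ c < b ∧ ω a c ≤ ω a b / 2 ∧ ω (c + 1) b ≤ ω a b / 2 := by
  have h0 := h.nonneg a b
  obtain ⟨c, h1, h2, h3, h4⟩ := h.exists_longest (θ := ω a b / 2) (by linarith) hab
  refine ⟨c, h1, h2, h3, ?_⟩
  rcases (show c + 1 ≤ b by omega).lt_or_eq with h5 | h5
  · have := h.superadd a (c + 1) b (by omega) h5.le
    have := h4 h5
    linarith
  · rw [h5, h.self_eq_zero]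
    linarith

theorem sum_le (h : IsControl ω) {a b : ℤ} {K : ℕ} {N : Fin (K + 1) → ℤ}
    (hN : Monotone N) (ha : ∀ j, a ≤ N j) (hb : ∀ j, N j ≤ b) :
    ∑ j : Fin K, ω (N j.castSucc) (N j.succ) ≤ ω a b := by
  suffices H : ∀ k (hk : k ≤ K), ∑ j : Fin k, ω (N (j.castSucc.castLE (by omega)))
      (N (j.succ.castLE (by omega))) ≤ ω a (N ⟨k, by omega⟩) by
    refine (H K le_rfl).trans (h.mono le_rfl (ha _) (hb _))
  intro k
  induction k with
  | zero => intro _; simpa using h.nonneg _ _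
  | succ k ih =>
    intro hk
    rw [Fin.sum_univ_castSucc]
    have h1 := ih (by omega)
    have h2 := h.superadd a (N ⟨k, by omega⟩) (N ⟨k + 1, by omega⟩) (ha _)
      (hN (by simp))
    refine le_trans ?_ h2
    exact add_le_add h1 le_rfl

end IsControl

/-! ### Elementary inequalities for powers -/

theorem add_rpow_le_two_rpow_mul {r x y : ℝ} (hr : 0 ≤ r) (hx : 0 ≤ x) (hy : 0 ≤ y) :
    (x + y) ^ r ≤ 2 ^ r * (x ^ r + y ^ r) := by
  have hx' := Real.rpow_nonneg hx r
  have hy' := Real.rpow_nonneg hy r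
  rcases le_total x y with h | h
  · calc (x + y) ^ r ≤ (2 * y) ^ r := Real.rpow_le_rpow (by positivity) (by linarith) hr
      _ = 2 ^ r * y ^ r := Real.mul_rpow (by norm_num) hy
      _ ≤ _ := by gcongr; linarith
  · calc (x + y) ^ r ≤ (2 * x) ^ r := Real.rpow_le_rpow (by positivity) (by linarith) hr
      _ = 2 ^ r * x ^ r := Real.mul_rpow (by norm_num) hx
      _ ≤ _ := by gcongr; linarith

/-- In `(x + y) ^ r` the coefficient of `y ^ r` can be taken arbitrarily close to `1`. -/
theorem exists_add_rpow_le {r l : ℝ} (hr : 0 < r) (hl : 1 < l) :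
    ∃ K : ℝ, 1 ≤ K ∧ ∀ x y : ℝ, 0 ≤ x → 0 ≤ y → (x + y) ^ r ≤ K * x ^ r + l * y ^ r := by
  set η : ℝ := l ^ (1 / r) - 1 with hη
  have hη0 : 0 < η := by
    have := Real.one_lt_rpow hl (show 0 < 1 / r by positivity)
    linarith
  have hl' : (1 + η) ^ r = l := by
    rw [hη, add_sub_cancel, ← Real.rpow_mul (by linarith), one_div_mul_cancel hr.ne', Real.rpow_one]
  refine ⟨(1 + 1 / η) ^ r, Real.one_le_rpow (by have : 0 < 1 / η := by positivity
                                                linarith) hr.le, fun x y hx hy => ?_⟩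
  have hx' := Real.rpow_nonneg hx r
  have hy' := Real.rpow_nonneg hy r
  rcases le_total x (η * y) with h | h
  · calc (x + y) ^ r ≤ ((1 + η) * y) ^ r :=
          Real.rpow_le_rpow (by positivity) (by linarith) hr.le
      _ = l * y ^ r := by rw [Real.mul_rpow (by positivity) hy, hl']
      _ ≤ _ := by
        have : 0 ≤ (1 + 1 / η) ^ r * x ^ r := by positivity
        linarith
  · have h2 : y ≤ x / η := by rw [le_div_iff₀ hη0]; linarith
    calc (x + y) ^ r ≤ ((1 + 1 / η) * x) ^ r :=
          Real.rpow_le_rpow (by positivity) (by rw [add_mul, one_div_mul_eq_div]; linarith) hr.le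
      _ = (1 + 1 / η) ^ r * x ^ r := by rw [Real.mul_rpow (by positivity) hx]
      _ ≤ _ := by
        have : 0 ≤ l * y ^ r := by positivity
        linarith

/-! ### The variational Christ–Kiselev argument -/

/-- The control of an interval is built from the controls `ω₁`, `ω₂` of the two pieces left and
right of the splitting point `c`, the `r`-th powers `s` and `t` of the full sum and of the term at
`c`, each counted only for intervals that contain its support. -/
theorem IsControl.glue {ω₁ ω₂ : ℤ → ℤ → ℝ} (h₁ : IsControl ω₁) (h₂ : IsControl ω₂) {a b c : ℤ}
    (hab : a < b) {s t l : ℝ} (hs : 0 ≤ s) (ht : 0 ≤ t) (hl : 0 ≤ l) :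
    IsControl fun M N => (if M ≤ a ∧ b ≤ N then s else 0) + (if M ≤ c ∧ c + 1 ≤ N then t else 0) +
      l * (ω₁ M N + ω₂ M N) where
  nonneg M N := by
    have := h₁.nonneg M N
    have := h₂.nonneg M N
    positivity
  superadd M N L hMN hNL := by
    have e1 : (if M ≤ a ∧ b ≤ N then s else 0) + (if N ≤ a ∧ b ≤ L then s else 0) ≤
        if M ≤ a ∧ b ≤ L then s else 0 := by
      split_ifs <;> first | omega | linarith
    have e2 : (if M ≤ c ∧ c + 1 ≤ N then t else 0) + (if N ≤ c ∧ c + 1 ≤ L then t else 0) ≤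
        if M ≤ c ∧ c + 1 ≤ L then t else 0 := by
      split_ifs <;> first | omega | linarith
    have e3 := mul_le_mul_of_nonneg_left
      (add_le_add (h₁.superadd M N L hMN hNL) (h₂.superadd M N L hMN hNL)) hl
    linarith

/-- The variational Christ–Kiselev lemma, for exponents `κ > 1`: if the functions `S a b` are
additive in the interval `[a, b)` and the norms of `‖S a b‖ ^ r` are bounded by `μ a b ^ κ` for a
control `μ`, then on every finite interval the `r`-th powers of all increments are dominated by a
control, depending measurably on the point `x`, whose total mass has norm at most a constant times
`μ a b ^ κ`. In particular the `r`-variation of the partial sums obeys the same bound as a single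
sum.

The control is a sum over the nodes of a binary tree of intervals, obtained by repeatedly splitting
with respect to `μ`, that are contained in the given interval. Splitting off a single point at
each step is what keeps the masses of both children below half, even if `μ` has large atoms. -/
theorem exists_dominating_control {r κ : ℝ} (hr : 1 ≤ r) (hκ : 1 < κ) :
    ∃ C B : ℝ, 0 ≤ C ∧ 0 ≤ B ∧ ∀ {X : Type} [MeasurableSpace X] (ν : Measure X) (q : ℝ≥0∞)
      (S : ℤ → ℤ → X → ℂ) (μ : ℤ → ℤ → ℝ), 1 ≤ q → (∀ a b, Measurable (S a b)) →
      (∀ a b c x, a ≤ b → b ≤ c → S a b x + S b c x = S a c x) → IsControl μ →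
      (∀ a b, a ≤ b → eLpNorm (fun x => ‖S a b x‖ ^ r) q ν ≤ ENNReal.ofReal (μ a b ^ κ)) →
      ∀ a b, a ≤ b → ∃ ω : X → ℤ → ℤ → ℝ, (∀ x, IsControl (ω x)) ∧
        (∀ M N, Measurable fun x => ω x M N) ∧
        (∀ x M N, a ≤ M → M ≤ N → N ≤ b → ‖S M N x‖ ^ r ≤ C * ω x M N) ∧
        eLpNorm (fun x => ω x a b) q ν ≤ ENNReal.ofReal (B * μ a b ^ κ) := by
  have hr0 : 0 < r := by linarith
  -- The factor `l` is paid per generation of the tree; the norms gain `2 ^ (1 - κ)` per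
  -- generation, and `l * 2 ^ (1 - κ) < 1`.
  set l : ℝ := 2 ^ ((κ - 1) / 2) with hl
  have hl1 : 1 < l := Real.one_lt_rpow (by norm_num) (by linarith)
  set ρ : ℝ := 2 ^ (-((κ - 1) / 2)) with hρ
  have hρ1 : ρ < 1 := Real.rpow_lt_one_of_one_lt_of_neg (by norm_num) (by linarith)
  have hρ0 : 0 < ρ := by positivity
  have hlρ : l * 2 * (1 / 2) ^ κ = ρ := by
    rw [hl, hρ, one_div, Real.inv_rpow (by norm_num), ← Real.rpow_neg (by norm_num),
      mul_comm (_ ^ _) (2 : ℝ), mul_assoc, ← Real.rpow_add (by norm_num)]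
    nth_rewrite 1 [← Real.rpow_one (2 : ℝ)]
    rw [← Real.rpow_add (by norm_num)]
    congr 1
    ring
  obtain ⟨K, hK1, hK⟩ := exists_add_rpow_le hr0 hl1
  set C₁ : ℝ := K * 2 ^ r with hC₁
  have h2r : (1 : ℝ) ≤ 2 ^ r := Real.one_le_rpow (by norm_num) hr0.le
  have hC₁1 : 1 ≤ C₁ := one_le_mul_of_one_le_of_one_le hK1 h2r
  set C : ℝ := 2 ^ r * (C₁ * 2) * 2 ^ r with hC
  have hB : 0 < 2 / (1 - ρ) := div_pos (by norm_num) (by linarith)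
  refine ⟨C, 2 / (1 - ρ), by positivity, hB.le, ?_⟩
  intro X _ ν q S μ hq hSm hSadd hμ hS
  -- The induction also carries the better estimates for initial and final pieces of `[a, b)`.
  suffices H : ∀ n : ℕ, ∀ a b, a ≤ b → (b - a).toNat ≤ n → ∃ ω : X → ℤ → ℤ → ℝ,
      (∀ x, IsControl (ω x)) ∧
      (∀ M N, Measurable fun x => ω x M N) ∧
      (∀ x M N, a ≤ M → M ≤ N → N ≤ b → ‖S M N x‖ ^ r ≤ C * ω x M N) ∧
      (∀ x M, a ≤ M → M ≤ b → ‖S M b x‖ ^ r ≤ C₁ * ω x M b) ∧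
      (∀ x N, a ≤ N → N ≤ b → ‖S a N x‖ ^ r ≤ C₁ * ω x a N) ∧
      (∀ x, ‖S a b x‖ ^ r ≤ ω x a b) ∧
      (∀ x M N, M ≤ N → ω x M N ≤ ω x a b) ∧
      eLpNorm (fun x => ω x a b) q ν ≤ ENNReal.ofReal (2 / (1 - ρ) * μ a b ^ κ) by
    intro a b hab
    obtain ⟨ω, h1, h2, h3, -, -, -, -, h4⟩ := H _ a b hab le_rfl
    exact ⟨ω, h1, h2, h3, h4⟩
  have hS0 : ∀ a x, ‖S a a x‖ ^ r = 0 := fun a x => by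
    have := hSadd a a a x le_rfl le_rfl
    rw [add_eq_left] at this
    rw [this, norm_zero, Real.zero_rpow hr0.ne']
  have hnn : ∀ a b x, 0 ≤ ‖S a b x‖ ^ r := fun a b x => by positivity
  intro n
  induction n with
  | zero =>
    intro a b hab hn
    obtain rfl : a = b := by omega
    refine ⟨fun _ _ _ => 0, fun x => ⟨fun _ _ => le_rfl, fun _ _ _ _ _ => by simp⟩,
      fun _ _ => measurable_const, ?_, ?_, ?_, ?_, fun _ _ _ _ => le_rfl, ?_⟩
    · intro x M N h1 h2 h3
      obtain rfl : M = a := by omega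
      obtain rfl : N = M := by omega
      simp [hS0]
    · intro x M h1 h2
      obtain rfl : M = a := by omega
      simp [hS0]
    · intro x M h1 h2
      obtain rfl : M = a := by omega
      simp [hS0]
    · intro x
      simp [hS0]
    · simp
  | succ n ih =>
    intro a b hab hn
    rcases hab.eq_or_lt with rfl | hab
    · exact ih a a le_rfl (by simp)
    obtain ⟨c, hac, hcb, hm1, hm2⟩ := hμ.exists_split hab
    obtain ⟨ω₁, hω₁, mω₁, two₁, tail₁, head₁, all₁, tot₁, norm₁⟩ := ih a c hac (by omega)
    obtain ⟨ω₂, hω₂, mω₂, two₂, tail₂, head₂, all₂, tot₂, norm₂⟩ := ih (c + 1) b hcb (by omega)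
    have hc1 : c ≤ c + 1 := by omega
    have hsplit : ∀ x M N, M ≤ c → c + 1 ≤ N →
        S M N x = S M c x + S c (c + 1) x + S (c + 1) N x := fun x M N h1 h2 => by
      rw [hSadd _ _ _ x h1 hc1, hSadd _ _ _ x (h1.trans hc1) h2]
    set ω : X → ℤ → ℤ → ℝ := fun x M N => (if M ≤ a ∧ b ≤ N then ‖S a b x‖ ^ r else 0) +
      (if M ≤ c ∧ c + 1 ≤ N then ‖S c (c + 1) x‖ ^ r else 0) + l * (ω₁ x M N + ω₂ x M N) with hω
    have hωc : ∀ x, IsControl (ω x) := fun x =>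
      (hω₁ x).glue (hω₂ x) hab (by positivity) (by positivity) (by positivity)
    have hωlow : ∀ x M N, M ≤ c → c + 1 ≤ N →
        ‖S c (c + 1) x‖ ^ r + l * (ω₁ x M N + ω₂ x M N) ≤ ω x M N := fun x M N h1 h2 => by
      simp only [hω]
      rw [if_pos (⟨h1, h2⟩ : M ≤ c ∧ c + 1 ≤ N)]
      have : 0 ≤ if M ≤ a ∧ b ≤ N then ‖S a b x‖ ^ r else 0 := by positivity
      linarith
    have hω1 : ∀ x M N, ω₁ x M N ≤ ω x M N := fun x M N => by
      simp only [hω]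
      have h1 : 0 ≤ if M ≤ a ∧ b ≤ N then ‖S a b x‖ ^ r else 0 := by positivity
      have h2 : 0 ≤ if M ≤ c ∧ c + 1 ≤ N then ‖S c (c + 1) x‖ ^ r else 0 := by positivity
      have h3 := (hω₁ x).nonneg M N
      have h4 := (hω₂ x).nonneg M N
      nlinarith
    have hω2 : ∀ x M N, ω₂ x M N ≤ ω x M N := fun x M N => by
      simp only [hω]
      have h1 : 0 ≤ if M ≤ a ∧ b ≤ N then ‖S a b x‖ ^ r else 0 := by positivity
      have h2 : 0 ≤ if M ≤ c ∧ c + 1 ≤ N then ‖S c (c + 1) x‖ ^ r else 0 := by positivity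
      have h3 := (hω₁ x).nonneg M N
      have h4 := (hω₂ x).nonneg M N
      nlinarith
    -- A term at `c` followed or preceded by a whole piece, and a proper part of the other piece.
    have hone : ∀ (u v w : ℂ) (p₁ p₂ : ℝ), 0 ≤ p₂ → ‖u‖ ^ r ≤ C₁ * p₁ → ‖w‖ ^ r ≤ p₂ →
        ‖u + v + w‖ ^ r ≤ C₁ * (‖v‖ ^ r + l * (p₁ + p₂)) := by
      intro u v w p₁ p₂ hp₂ h1 h2
      have h3 : ‖u + v + w‖ ≤ (‖v‖ + ‖w‖) + ‖u‖ := by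
        have h4 := norm_add_le (u + v) w
        have h5 := norm_add_le u v
        linarith
      calc ‖u + v + w‖ ^ r ≤ ((‖v‖ + ‖w‖) + ‖u‖) ^ r :=
            Real.rpow_le_rpow (norm_nonneg _) h3 hr0.le
        _ ≤ K * (‖v‖ + ‖w‖) ^ r + l * ‖u‖ ^ r := hK _ _ (by positivity) (by positivity)
        _ ≤ K * (2 ^ r * (‖v‖ ^ r + ‖w‖ ^ r)) + l * ‖u‖ ^ r := by
            gcongr
            exact add_rpow_le_two_rpow_mul hr0.le (norm_nonneg _) (norm_nonneg _)
        _ ≤ K * (2 ^ r * (‖v‖ ^ r + l * p₂)) + l * (C₁ * p₁) := by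
            gcongr
            nlinarith
        _ = C₁ * (‖v‖ ^ r + l * (p₁ + p₂)) := by rw [hC₁]; ring
    refine ⟨ω, hωc, ?_, ?_, ?_, ?_, ?_, ?_, ?_⟩
    · intro M N
      have m1 := ((hSm a b).norm.pow_const r)
      have m2 := ((hSm c (c + 1)).norm.pow_const r)
      have m3 := mω₁ M N
      have m4 := mω₂ M N
      simp only [hω]
      refine (Measurable.add ?_ ?_).add ((m3.add m4).const_mul l)
      · split_ifs
        exacts [m1, measurable_const]
      · split_ifs
        exacts [m2, measurable_const]
    · intro x M N h1 h2 h3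
      rcases le_or_gt N c with h4 | h4
      · exact (two₁ x M N h1 h2 h4).trans (by gcongr; exact hω1 x M N)
      rcases lt_or_ge c M with h5 | h5
      · exact (two₂ x M N h5 h2 h3).trans (by gcongr; exact hω2 x M N)
      have h6 := tail₁ x M h1 h5
      have h7 := head₂ x N h4 h3
      have h8 := (hω₁ x).mono (le_refl M) h5 (hc1.trans h4)
      have h9 := (hω₂ x).mono (h5.trans hc1) h4 (le_refl N)
      have h10 := hωlow x M N h5 h4
      have h11 := (hω₁ x).nonneg M N
      have h12 := (hω₂ x).nonneg M N
      have h13 := (hω₁ x).nonneg M c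
      have h14 := (hω₂ x).nonneg (c + 1) N
      rw [hsplit x M N h5 h4]
      calc ‖S M c x + S c (c + 1) x + S (c + 1) N x‖ ^ r
          ≤ ((‖S M c x‖ + ‖S c (c + 1) x‖) + ‖S (c + 1) N x‖) ^ r :=
            Real.rpow_le_rpow (norm_nonneg _) (norm_add₃_le) hr0.le
        _ ≤ 2 ^ r * ((‖S M c x‖ + ‖S c (c + 1) x‖) ^ r + ‖S (c + 1) N x‖ ^ r) :=
            add_rpow_le_two_rpow_mul hr0.le (by positivity) (by positivity)
        _ ≤ 2 ^ r * (2 ^ r * (‖S M c x‖ ^ r + ‖S c (c + 1) x‖ ^ r) + ‖S (c + 1) N x‖ ^ r) := by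
            gcongr
            exact add_rpow_le_two_rpow_mul hr0.le (by positivity) (by positivity)
        _ ≤ 2 ^ r * (2 ^ r * (C₁ * ω₁ x M N + C₁ * ‖S c (c + 1) x‖ ^ r) +
              2 ^ r * (C₁ * ω₂ x M N)) := by
            gcongr
            · exact h6.trans (by gcongr)
            · exact le_mul_of_one_le_left (hnn _ _ _) hC₁1
            · exact (h7.trans (by gcongr)).trans (le_mul_of_one_le_left (by positivity) h2r)
        _ = 2 ^ r * C₁ * 2 ^ r * (‖S c (c + 1) x‖ ^ r + 1 * (ω₁ x M N + ω₂ x M N)) := by ring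
        _ ≤ 2 ^ r * C₁ * 2 ^ r * (‖S c (c + 1) x‖ ^ r + l * (ω₁ x M N + ω₂ x M N)) := by gcongr
        _ ≤ 2 ^ r * (C₁ * 2) * 2 ^ r * ω x M N := by
            have := (hωc x).nonneg M N
            gcongr
            linarith
    · intro x M h1 h2
      rcases lt_or_ge c M with h5 | h5
      · exact (tail₂ x M h5 h2).trans (by gcongr; exact hω2 x M b)
      have h8 := (hω₁ x).mono (le_refl M) h5 hcb.le
      have h9 := (hω₂ x).mono (h5.trans hc1) hcb (le_refl b)
      rw [hsplit x M b h5 hcb]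
      refine (hone _ _ _ (ω₁ x M b) (ω₂ x M b) ((hω₂ x).nonneg _ _) ?_ ?_).trans ?_
      · exact (tail₁ x M h1 h5).trans (by gcongr)
      · exact (all₂ x).trans h9
      · gcongr
        exact hωlow x M b h5 hcb
    · intro x N h1 h2
      rcases le_or_gt N c with h4 | h4
      · exact (head₁ x N h1 h4).trans (by gcongr; exact hω1 x a N)
      have h8 := (hω₁ x).mono (le_refl a) hac (hc1.trans h4)
      have h9 := (hω₂ x).mono (hac.trans hc1) h4 (le_refl N)
      rw [hsplit x a N hac h4,
        show S a c x + S c (c + 1) x + S (c + 1) N x = S (c + 1) N x + S c (c + 1) x + S a c x by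
          ring]
      refine (hone _ _ _ (ω₂ x a N) (ω₁ x a N) ((hω₁ x).nonneg _ _) ?_ ?_).trans ?_
      · exact (head₂ x N h4 h2).trans (by gcongr)
      · exact (all₁ x).trans h8
      · gcongr
        rw [add_comm (ω₂ x a N)]
        exact hωlow x a N hac h4
    · intro x
      simp only [hω]
      rw [if_pos (⟨le_rfl, le_rfl⟩ : a ≤ a ∧ b ≤ b)]
      have h2 : 0 ≤ if a ≤ c ∧ c + 1 ≤ b then ‖S c (c + 1) x‖ ^ r else 0 := by positivity
      have h3 := (hω₁ x).nonneg a b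
      have h4 := (hω₂ x).nonneg a b
      have h5 : 0 ≤ l * (ω₁ x a b + ω₂ x a b) := by positivity
      linarith
    · intro x M N hMN
      have h1 := (tot₁ x M N hMN).trans ((hω₁ x).mono (le_refl a) hac hcb.le)
      have h2 := (tot₂ x M N hMN).trans ((hω₂ x).mono (hac.trans hc1) hcb (le_refl b))
      simp only [hω]
      rw [if_pos (⟨le_rfl, le_rfl⟩ : a ≤ a ∧ b ≤ b), if_pos (⟨hac, hcb⟩ : a ≤ c ∧ c + 1 ≤ b)]
      gcongr
      · split_ifs
        exacts [le_rfl, hnn _ _ _]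
      · split_ifs
        exacts [le_rfl, hnn _ _ _]
    · set B : ℝ := 2 / (1 - ρ) with hBdef
      have e1 : (fun x => ω₁ x a b) = fun x => ω₁ x a c := funext fun x =>
        le_antisymm (tot₁ x a b hab.le) ((hω₁ x).mono (le_refl a) hac hcb.le)
      have e2 : (fun x => ω₂ x a b) = fun x => ω₂ x (c + 1) b := funext fun x =>
        le_antisymm (tot₂ x a b hab.le) ((hω₂ x).mono (hac.trans hc1) hcb (le_refl b))
      have hm0 := hμ.nonneg a b
      have k1 : μ a c ^ κ ≤ (1 / 2) ^ κ * μ a b ^ κ := by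
        rw [← Real.mul_rpow (by norm_num) hm0]
        exact Real.rpow_le_rpow (hμ.nonneg _ _) (by linarith) (by linarith)
      have k2 : μ (c + 1) b ^ κ ≤ (1 / 2) ^ κ * μ a b ^ κ := by
        rw [← Real.mul_rpow (by norm_num) hm0]
        exact Real.rpow_le_rpow (hμ.nonneg _ _) (by linarith) (by linarith)
      have k3 : μ c (c + 1) ^ κ ≤ μ a b ^ κ :=
        Real.rpow_le_rpow (hμ.nonneg _ _) (hμ.mono hac hc1 hcb) (by linarith)
      have eω : (fun x => ω x a b) = (fun x => ‖S a b x‖ ^ r) + (fun x => ‖S c (c + 1) x‖ ^ r) +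
          l • ((fun x => ω₁ x a b) + fun x => ω₂ x a b) := by
        funext x
        simp only [hω]
        rw [if_pos (⟨le_rfl, le_rfl⟩ : a ≤ a ∧ b ≤ b), if_pos (⟨hac, hcb⟩ : a ≤ c ∧ c + 1 ≤ b)]
        rfl
      have m1 := ((hSm a b).norm.pow_const r).aestronglyMeasurable (μ := ν)
      have m2 := ((hSm c (c + 1)).norm.pow_const r).aestronglyMeasurable (μ := ν)
      have m3 := (mω₁ a b).aestronglyMeasurable (μ := ν)
      have m4 := (mω₂ a b).aestronglyMeasurable (μ := ν)
      rw [eω]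
      calc _ ≤ eLpNorm (fun x => ‖S a b x‖ ^ r) q ν + eLpNorm (fun x => ‖S c (c + 1) x‖ ^ r) q ν +
              ENNReal.ofReal l * (eLpNorm (fun x => ω₁ x a b) q ν +
                eLpNorm (fun x => ω₂ x a b) q ν) := by
            refine (eLpNorm_add_le (m1.add m2) ((m3.add m4).const_smul l) hq).trans ?_
            gcongr
            · exact eLpNorm_add_le m1 m2 hq
            · rw [eLpNorm_const_smul, Real.enorm_eq_ofReal (by positivity)]
              gcongr
              exact eLpNorm_add_le m3 m4 hq
        _ ≤ ENNReal.ofReal (μ a b ^ κ) + ENNReal.ofReal (μ a b ^ κ) + ENNReal.ofReal l *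
              (ENNReal.ofReal (B * ((1 / 2) ^ κ * μ a b ^ κ)) +
                ENNReal.ofReal (B * ((1 / 2) ^ κ * μ a b ^ κ))) := by
            gcongr
            · exact hS a b hab.le
            · exact (hS c (c + 1) hc1).trans (ENNReal.ofReal_le_ofReal k3)
            · rw [e1]
              exact norm₁.trans (ENNReal.ofReal_le_ofReal (by gcongr))
            · rw [e2]
              exact norm₂.trans (ENNReal.ofReal_le_ofReal (by gcongr))
        _ = ENNReal.ofReal (B * μ a b ^ κ) := by
            rw [← ENNReal.ofReal_add (by positivity) (by positivity),
              ← ENNReal.ofReal_add (by positivity) (by positivity),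
              ← ENNReal.ofReal_mul (by positivity),
              ← ENNReal.ofReal_add (by positivity) (by positivity)]
            congr 1
            have hB2 : B * (1 - ρ) = 2 := div_mul_cancel₀ _ (by linarith)
            linear_combination (B * μ a b ^ κ) * hlρ - μ a b ^ κ * hB2

/-! ### Ordered products controlled by sums -/

/-- The defect of a product of three factors from its linearization, in terms of the defects of the
factors. -/
theorem norm_mul_mul_sub_le {A : Type*} [NormedRing A] {p₁ p₂ p₃ w₁ w₂ w₃ : A} {w : ℝ}
    (h₁ : ‖p₁ - 1‖ ≤ 2 * w) (h₂ : ‖p₂ - 1‖ ≤ 2 * w) (h₃ : ‖p₃ - 1‖ ≤ 2 * w) (hw : w ≤ 1) :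
    ‖p₁ * p₂ * p₃ - 1 - (w₁ + w₂ + w₃)‖ ≤
      ‖p₁ - 1 - w₁‖ + ‖p₂ - 1 - w₂‖ + ‖p₃ - 1 - w₃‖ + 20 * w ^ 2 := by
  have hw0 : 0 ≤ 2 * w := (norm_nonneg _).trans h₁
  have e : p₁ * p₂ * p₃ - 1 - (w₁ + w₂ + w₃) =
      (p₁ - 1 - w₁) + (p₂ - 1 - w₂) + (p₃ - 1 - w₃) + (p₁ - 1) * (p₂ - 1) +
        (p₁ - 1) * (p₃ - 1) + (p₂ - 1) * (p₃ - 1) + (p₁ - 1) * (p₂ - 1) * (p₃ - 1) := by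
    noncomm_ring
  have m12 : ‖(p₁ - 1) * (p₂ - 1)‖ ≤ 2 * w * (2 * w) :=
    norm_mul_le_of_le h₁ h₂
  have m13 : ‖(p₁ - 1) * (p₃ - 1)‖ ≤ 2 * w * (2 * w) :=
    norm_mul_le_of_le h₁ h₃
  have m23 : ‖(p₂ - 1) * (p₃ - 1)‖ ≤ 2 * w * (2 * w) :=
    norm_mul_le_of_le h₂ h₃
  have m123 : ‖(p₁ - 1) * (p₂ - 1) * (p₃ - 1)‖ ≤ 2 * w * (2 * w) * (2 * w) :=
    norm_mul_le_of_le m12 h₃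
  have t1 := norm_add_le ((p₁ - 1 - w₁) + (p₂ - 1 - w₂) + (p₃ - 1 - w₃) + (p₁ - 1) * (p₂ - 1) +
        (p₁ - 1) * (p₃ - 1) + (p₂ - 1) * (p₃ - 1)) ((p₁ - 1) * (p₂ - 1) * (p₃ - 1))
  have t2 := norm_add_le ((p₁ - 1 - w₁) + (p₂ - 1 - w₂) + (p₃ - 1 - w₃) + (p₁ - 1) * (p₂ - 1) +
        (p₁ - 1) * (p₃ - 1)) ((p₂ - 1) * (p₃ - 1))
  have t3 := norm_add_le ((p₁ - 1 - w₁) + (p₂ - 1 - w₂) + (p₃ - 1 - w₃) + (p₁ - 1) * (p₂ - 1))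
    ((p₁ - 1) * (p₃ - 1))
  have t4 := norm_add_le ((p₁ - 1 - w₁) + (p₂ - 1 - w₂) + (p₃ - 1 - w₃)) ((p₁ - 1) * (p₂ - 1))
  have t5 : ‖(p₁ - 1 - w₁) + (p₂ - 1 - w₂) + (p₃ - 1 - w₃)‖ ≤ _ := norm_add₃_le
  rw [e]
  have : 2 * w * (2 * w) * (2 * w) ≤ 8 * w ^ 2 := by nlinarith [sq_nonneg w]
  nlinarith

/-- The local estimate behind Lyons' theorem below the exponent `2`: if the increments `W a b` are
bounded by `ω a b ^ α` for a control `ω` and some `α > 1 / 2`, then on intervals where `ω` is small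
the ordered product agrees with `1 + W a b` up to a quadratic error.  The interval is bisected
with respect to `ω`; the errors of the halves add up to a proper fraction of the claimed bound
because `2 * α > 1`, which leaves room for the cross terms. -/
theorem exists_norm_sub_one_sub_le {α : ℝ} (hα : 1 / 2 < α) :
    ∃ K : ℝ, 1 ≤ K ∧ ∀ {A : Type} [NormedRing A] (P W : ℤ → ℤ → A) (ω : ℤ → ℤ → ℝ) (lo hi : ℤ),
      IsControl ω → (∀ a, P a a = 1) → (∀ a b c, a ≤ b → b ≤ c → P a b * P b c = P a c) →
      (∀ a b c, a ≤ b → b ≤ c → W a b + W b c = W a c) →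
      (∀ a b, lo ≤ a → a ≤ b → b ≤ hi → ‖W a b‖ ≤ ω a b ^ α) →
      (∀ a, lo ≤ a → a + 1 ≤ hi → ω a (a + 1) ≤ 1 →
        ‖P a (a + 1) - 1 - W a (a + 1)‖ ≤ (ω a (a + 1) ^ α) ^ 2) →
      ∀ a b, lo ≤ a → a ≤ b → b ≤ hi → K * ω a b ^ α ≤ 1 →
        ‖P a b - 1 - W a b‖ ≤ K * (ω a b ^ α) ^ 2 := by
  have hα0 : 0 < α := by linarith
  set θ : ℝ := 2 * ((1 / 2) ^ α) ^ 2 with hθ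
  have hθ0 : 0 < θ := by positivity
  have hθ1 : θ < 1 := by
    have h1 : ((1 / 2 : ℝ) ^ α) ^ 2 = (1 / 2) ^ (2 * α) := by
      rw [← Real.rpow_natCast, ← Real.rpow_mul (by norm_num), mul_comm]
      norm_num
    have h2 : (1 / 2 : ℝ) ^ (2 * α) < (1 / 2) ^ (1 : ℝ) :=
      Real.rpow_lt_rpow_of_exponent_gt (by norm_num) (by norm_num) (by linarith)
    rw [Real.rpow_one] at h2
    rw [hθ, h1]
    linarith
  set K : ℝ := 21 / (1 - θ) with hK
  have hKθ : K * (1 - θ) = 21 := div_mul_cancel₀ _ (by linarith)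
  have hK1 : 1 ≤ K := by
    rw [hK, le_div_iff₀ (by linarith)]
    linarith
  refine ⟨K, hK1, ?_⟩
  intro A _ P W ω lo hi hω hP1 hP hW hWω hstep
  have hW0 : ∀ a, W a a = 0 := fun a => by simpa using hW a a a le_rfl le_rfl
  suffices H : ∀ n : ℕ, ∀ a b, lo ≤ a → a ≤ b → b ≤ hi → (b - a).toNat ≤ n →
      K * ω a b ^ α ≤ 1 → ‖P a b - 1 - W a b‖ ≤ K * (ω a b ^ α) ^ 2 from
    fun a b h1 h2 h3 => H _ a b h1 h2 h3 le_rfl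
  intro n
  induction n with
  | zero =>
    intro a b _ hab _ hn _
    obtain rfl : a = b := by omega
    rw [hP1, hW0]
    simp only [sub_self, norm_zero]
    positivity
  | succ n ih =>
    intro a b ha hab hb hn hsmall
    rcases hab.eq_or_lt with rfl | hab
    · exact ih a a ha le_rfl hb (by simp) hsmall
    obtain ⟨c, hac, hcb, hm1, hm2⟩ := hω.exists_split hab
    set w := ω a b ^ α with hw
    have hω0 := hω.nonneg a b
    have hw0 : 0 ≤ w := Real.rpow_nonneg hω0 _
    have hw1 : w ≤ 1 := le_trans (le_mul_of_one_le_left hw0 hK1) hsmall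
    have hω1 : ω a b ≤ 1 := by
      by_contra! h
      exact absurd (Real.one_lt_rpow h hα0) (not_lt.2 hw1)
    have half : ∀ x y, ω x y ≤ ω a b / 2 → ω x y ^ α ≤ (1 / 2) ^ α * w := fun x y h => by
      rw [hw, ← Real.mul_rpow (by norm_num) hω0]
      exact Real.rpow_le_rpow (hω.nonneg _ _) (by linarith) hα0.le
    have hhalf1 : (1 / 2 : ℝ) ^ α ≤ 1 := Real.rpow_le_one (by norm_num) (by norm_num) hα0.le
    have piece : ∀ x y, lo ≤ x → x ≤ y → y ≤ hi → (y - x).toNat ≤ n → ω x y ≤ ω a b / 2 →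
        ‖P x y - 1 - W x y‖ ≤ K * (θ / 2) * w ^ 2 ∧ ‖P x y - 1‖ ≤ 2 * w := by
      intro x y h1 h2 h3 h4 h5
      have h6 := half x y h5
      have h60 : 0 ≤ ω x y ^ α := Real.rpow_nonneg (hω.nonneg _ _) _
      have h7 : ω x y ^ α ≤ w := h6.trans (mul_le_of_le_one_left hw0 hhalf1)
      have h8 : K * ω x y ^ α ≤ 1 := le_trans (by gcongr) hsmall
      have h9 := ih x y h1 h2 h3 h4 h8
      refine ⟨h9.trans ?_, ?_⟩
      · calc K * (ω x y ^ α) ^ 2 ≤ K * ((1 / 2) ^ α * w) ^ 2 := by gcongr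
          _ = K * (θ / 2) * w ^ 2 := by rw [hθ]; ring
      · have h10 := norm_add_le (P x y - 1 - W x y) (W x y)
        rw [sub_add_cancel] at h10
        have h11 := hWω x y h1 h2 h3
        have h12 : K * (ω x y ^ α) ^ 2 ≤ ω x y ^ α := by nlinarith
        linarith
    obtain ⟨b1, c1⟩ := piece a c ha hac (by omega) (by omega) hm1
    obtain ⟨b3, c3⟩ := piece (c + 1) b (by omega) (by omega) hb (by omega) hm2
    have hmid : ω c (c + 1) ≤ ω a b := hω.mono hac (by omega) hcb
    have hmid' : ω c (c + 1) ^ α ≤ w := Real.rpow_le_rpow (hω.nonneg _ _) hmid hα0.le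
    have hmid0 : 0 ≤ ω c (c + 1) ^ α := Real.rpow_nonneg (hω.nonneg _ _) _
    have b2 : ‖P c (c + 1) - 1 - W c (c + 1)‖ ≤ w ^ 2 :=
      (hstep c (by omega) (by omega) (hmid.trans hω1)).trans (by gcongr)
    have c2 : ‖P c (c + 1) - 1‖ ≤ 2 * w := by
      have h10 := norm_add_le (P c (c + 1) - 1 - W c (c + 1)) (W c (c + 1))
      rw [sub_add_cancel] at h10
      have h11 := hWω c (c + 1) (by omega) (by omega) (by omega)
      nlinarith
    have key := norm_mul_mul_sub_le (w₁ := W a c) (w₂ := W c (c + 1)) (w₃ := W (c + 1) b)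
      c1 c2 c3 hw1
    rw [hP a c (c + 1) hac (by omega), hP a (c + 1) b (by omega) hcb,
      hW a c (c + 1) hac (by omega), hW a (c + 1) b (by omega) hcb] at key
    have : K * w ^ 2 = K * (θ / 2) * w ^ 2 + w ^ 2 + K * (θ / 2) * w ^ 2 + 20 * w ^ 2 := by
      linear_combination w ^ 2 * hKθ
    linarith

/-- The triangle inequality for `d(X, Y) = log (1 + ‖X⁻¹ * Y - 1‖)`, in its left-invariant form. -/
theorem log_one_add_norm_mul_sub_one_le {A : Type*} [NormedRing A] (p q : A) :
    Real.log (1 + ‖p * q - 1‖) ≤ Real.log (1 + ‖p - 1‖) + Real.log (1 + ‖q - 1‖) := by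
  have h1 := norm_nonneg (p - 1)
  have h2 := norm_nonneg (q - 1)
  have h3 := norm_nonneg (p * q - 1)
  rw [← Real.log_mul (by positivity) (by positivity)]
  apply Real.log_le_log (by positivity)
  have e : p * q - 1 = (p - 1) * (q - 1) + (p - 1) + (q - 1) := by noncomm_ring
  have h4 : ‖p * q - 1‖ ≤ ‖(p - 1) * (q - 1)‖ + ‖p - 1‖ + ‖q - 1‖ := by
    rw [e]
    exact norm_add₃_le
  have h5 := norm_mul_le (p - 1) (q - 1)
  nlinarith

/-- The global estimate behind Lyons' theorem below the exponent `2`: an interval is cut into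
pieces on which the control is at most a fixed small number, separated by single points; the number
of pieces is bounded by the control of the whole interval. -/
theorem exists_log_one_add_norm_sub_one_le {α : ℝ} (hα : 1 / 2 < α) (hα1 : α ≤ 1) :
    ∃ C : ℝ, 1 ≤ C ∧ ∀ {A : Type} [NormedRing A] (P W : ℤ → ℤ → A) (ω : ℤ → ℤ → ℝ) (lo hi : ℤ),
      IsControl ω → (∀ a, P a a = 1) → (∀ a b c, a ≤ b → b ≤ c → P a b * P b c = P a c) →
      (∀ a b c, a ≤ b → b ≤ c → W a b + W b c = W a c) →
      (∀ a b, lo ≤ a → a ≤ b → b ≤ hi → ‖W a b‖ ≤ ω a b ^ α) →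
      (∀ a, lo ≤ a → a + 1 ≤ hi → ω a (a + 1) ≤ 1 →
        ‖P a (a + 1) - 1 - W a (a + 1)‖ ≤ (ω a (a + 1) ^ α) ^ 2) →
      (∀ a, lo ≤ a → a + 1 ≤ hi → Real.log (1 + ‖P a (a + 1) - 1‖) ≤ ω a (a + 1) ^ α) →
      ∀ a b, lo ≤ a → a ≤ b → b ≤ hi →
        Real.log (1 + ‖P a b - 1‖) ≤ C * (ω a b ^ α + ω a b) := by
  have hα0 : 0 < α := by linarith
  obtain ⟨K, hK1, hK⟩ := exists_norm_sub_one_sub_le hα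
  have hK0 : 0 < K := by linarith
  set θ : ℝ := (1 / K) ^ (1 / α) with hθ
  have hθ0 : 0 < θ := by positivity
  have hθα : θ ^ α = 1 / K := by
    rw [hθ, ← Real.rpow_mul (by positivity), one_div_mul_cancel hα0.ne', Real.rpow_one]
  set M : ℝ := (2 / K + 1) / θ + 1 with hM
  refine ⟨2 + 2 / K / θ + M, ?_, ?_⟩
  · have : 0 ≤ 2 / K / θ := by positivity
    have : 0 ≤ M := by positivity
    linarith
  intro A _ P W ω lo hi hω hP1 hP hW hWω hstep hjump
  have small : ∀ a b, lo ≤ a → a ≤ b → b ≤ hi → ω a b ≤ θ →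
      Real.log (1 + ‖P a b - 1‖) ≤ 2 * ω a b ^ α ∧ Real.log (1 + ‖P a b - 1‖) ≤ 2 / K := by
    intro a b ha hab hb h
    have h0 : 0 ≤ ω a b ^ α := Real.rpow_nonneg (hω.nonneg _ _) _
    have h1 : ω a b ^ α ≤ 1 / K := by
      rw [← hθα]
      exact Real.rpow_le_rpow (hω.nonneg _ _) h hα0.le
    have h2 : K * ω a b ^ α ≤ 1 := by
      rw [le_div_iff₀ hK0] at h1
      linarith
    have h3 := hK P W ω lo hi hω hP1 hP hW hWω hstep a b ha hab hb h2
    have h4 := norm_add_le (P a b - 1 - W a b) (W a b)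
    rw [sub_add_cancel] at h4
    have h5 := hWω a b ha hab hb
    have h6 : K * (ω a b ^ α) ^ 2 ≤ ω a b ^ α := by nlinarith
    have h7 := Real.log_le_sub_one_of_pos (show 0 < 1 + ‖P a b - 1‖ by positivity)
    have h8 : (2 : ℝ) / K = 2 * (1 / K) := by ring
    constructor <;> linarith
  have large : ∀ n : ℕ, ∀ a b, lo ≤ a → a ≤ b → b ≤ hi → (b - a).toNat ≤ n →
      Real.log (1 + ‖P a b - 1‖) ≤ 2 / K + M * ω a b := by
    intro n
    induction n with
    | zero =>
      intro a b _ hab _ hn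
      obtain rfl : a = b := by omega
      have h0 := hω.nonneg a a
      rw [hP1, sub_self, norm_zero, add_zero, Real.log_one]
      positivity
    | succ n ih =>
      intro a b ha hab hb hn
      have h0 := hω.nonneg a b
      rcases le_or_gt (ω a b) θ with h | h
      · have h1 := (small a b ha hab hb h).2
        have : 0 ≤ M * ω a b := by positivity
        linarith
      rcases hab.eq_or_lt with rfl | hab
      · exact ih a a ha le_rfl hb (by simp)
      obtain ⟨c, hac, hcb, h1, h2⟩ := hω.exists_longest hθ0.le hab
      have h3 : θ < ω a (c + 1) := by
        rcases (show c + 1 ≤ b by omega).lt_or_eq with h5 | h5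
        · exact h2 h5
        · rwa [h5]
      have h4 := (small a c ha hac (by omega) h1).2
      have h5 := hjump c (by omega) (by omega)
      have h6 := ih (c + 1) b (by omega) hcb hb (by omega)
      have h7 := log_one_add_norm_mul_sub_one_le (P a c) (P c (c + 1))
      have h8 := log_one_add_norm_mul_sub_one_le (P a (c + 1)) (P (c + 1) b)
      rw [hP a c (c + 1) hac (by omega)] at h7
      rw [hP a (c + 1) b (by omega) hcb] at h8
      have h9 := hω.superadd a (c + 1) b (by omega) hcb
      have h10 : ω c (c + 1) ^ α ≤ 1 + ω a (c + 1) := by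
        have i0 := hω.nonneg c (c + 1)
        have i1 : ω c (c + 1) ≤ ω a (c + 1) := hω.mono hac (by omega) le_rfl
        rcases le_total (ω c (c + 1)) 1 with i | i
        · have := Real.rpow_le_one i0 i hα0.le
          linarith
        · have := Real.rpow_le_rpow_of_exponent_le i hα1
          rw [Real.rpow_one] at this
          linarith
      have h11 : 2 / K + 1 + ω a (c + 1) ≤ M * ω a (c + 1) := by
        have i1 : (2 / K + 1) ≤ (2 / K + 1) / θ * ω a (c + 1) := by
          rw [div_mul_eq_mul_div, le_div_iff₀ hθ0]
          gcongr
        rw [hM]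
        linarith
      have h12 : M * (ω a (c + 1) + ω (c + 1) b) ≤ M * ω a b := by gcongr
      linarith
  intro a b ha hab hb
  have h0 := hω.nonneg a b
  have h0' : 0 ≤ ω a b ^ α := Real.rpow_nonneg h0 _
  have hM0 : 0 ≤ M := by positivity
  have hc0 : 0 ≤ 2 / K / θ := by positivity
  rcases le_or_gt (ω a b) θ with h | h
  · have h1 := (small a b ha hab hb h).1
    have h2 : 0 ≤ (2 / K / θ + M) * (ω a b ^ α + ω a b) := by positivity
    linarith
  · have h1 := large _ a b ha hab hb le_rfl
    have h2 : 2 / K ≤ 2 / K / θ * ω a b := by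
      rw [div_mul_eq_mul_div, le_div_iff₀ hθ0]
      gcongr
    have h3 : 0 ≤ (2 + 2 / K / θ + M) * ω a b ^ α := by positivity
    linarith

/-! ### The Hausdorff–Young inequality for trigonometric polynomials -/

instance : IsProbabilityMeasure circleMeasure :=
  Measure.isProbabilityMeasure_map AddCircle.continuous_toCircle.measurable.aemeasurable

/-- The trigonometric polynomial with coefficients `f n`, for `n` in the finite set `s`. -/
noncomputable def trigSum (f : ℤ → ℂ) (s : Finset ℤ) (z : Circle) : ℂ :=
  ∑ n ∈ s, f n * (z : ℂ) ^ n

theorem continuous_coe_zpow (n : ℤ) : Continuous fun z : Circle => (z : ℂ) ^ n := by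
  have h : (fun z : Circle => (z : ℂ) ^ n) = fun z : Circle => ((z ^ n : Circle) : ℂ) := by
    funext z
    simp
  rw [h]
  exact continuous_subtype_val.comp (continuous_zpow n)

theorem continuous_trigSum (f : ℤ → ℂ) (s : Finset ℤ) : Continuous (trigSum f s) :=
  continuous_finsetSum _ fun n _ => continuous_const.mul (continuous_coe_zpow n)

theorem norm_coe_zpow (z : Circle) (n : ℤ) : ‖(z : ℂ) ^ n‖ = 1 := by
  rw [norm_zpow, Circle.norm_coe, one_zpow]

theorem norm_trigSum_le (f : ℤ → ℂ) (s : Finset ℤ) (z : Circle) :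
    ‖trigSum f s z‖ ≤ ∑ n ∈ s, ‖f n‖ :=
  (norm_sum_le _ _).trans (le_of_eq (Finset.sum_congr rfl fun n _ => by
    rw [norm_mul, norm_coe_zpow, mul_one]))

theorem lintegral_enorm_trigSum_sq (f : ℤ → ℂ) (s : Finset ℤ) :
    ∫⁻ z, ‖trigSum f s z‖ₑ ^ 2 ∂circleMeasure = ENNReal.ofReal (∑ n ∈ s, ‖f n‖ ^ 2) := by
  have : Fact ((0 : ℝ) < 1) := ⟨one_pos⟩
  rw [circleMeasure, lintegral_map ((continuous_trigSum f s).enorm.measurable.pow_const 2)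
    AddCircle.continuous_toCircle.measurable]
  set g : Lp ℂ 2 (AddCircle.haarAddCircle (T := (1 : ℝ))) :=
    ∑ n ∈ s, f n • fourierLp 2 n with hg
  have hnorm : ‖g‖ ^ 2 = ∑ n ∈ s, ‖f n‖ ^ 2 := by
    have h1 := (orthonormal_fourier (T := (1 : ℝ))).inner_sum f f s
    rw [← hg, inner_self_eq_norm_sq_to_K] at h1
    have h2 : ∑ n ∈ s, (starRingEnd ℂ) (f n) * f n = ((∑ n ∈ s, ‖f n‖ ^ 2 : ℝ) : ℂ) := by
      push_cast
      exact Finset.sum_congr rfl fun n _ => by rw [Complex.conj_mul']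
    rw [h2] at h1
    apply Complex.ofReal_injective
    simpa using h1
  have hcoe : (g : AddCircle (1 : ℝ) → ℂ) =ᵐ[AddCircle.haarAddCircle]
      fun x => trigSum f s (AddCircle.toCircle x) := by
    have h1 : (g : AddCircle (1 : ℝ) → ℂ) =ᵐ[AddCircle.haarAddCircle]
        fun x => ∑ n ∈ s, f n * (fourierLp (T := (1 : ℝ)) 2 n : AddCircle (1 : ℝ) → ℂ) x := by
      refine (Lp.coeFn_finsetSum s _).trans ?_
      have h2 : ∀ᵐ x ∂(AddCircle.haarAddCircle (T := (1 : ℝ))), ∀ n : ℤ,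
          (f n • fourierLp (T := (1 : ℝ)) 2 n : Lp ℂ 2 _) x =
            f n * fourierLp (T := (1 : ℝ)) 2 n x :=
        ae_all_iff.2 fun n => Lp.coeFn_smul _ _
      filter_upwards [h2] with x hx
      simp only [Finset.sum_apply]
      exact Finset.sum_congr rfl fun n _ => hx n
    have h3 : ∀ᵐ x ∂(AddCircle.haarAddCircle (T := (1 : ℝ))), ∀ n : ℤ,
        fourierLp (T := (1 : ℝ)) 2 n x = fourier n x := ae_all_iff.2 fun n => coeFn_fourierLp 2 n
    filter_upwards [h1, h3] with x hx hx3
    rw [hx, trigSum]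
    refine Finset.sum_congr rfl fun n _ => ?_
    rw [hx3, fourier_apply, AddCircle.toCircle_zsmul, Circle.coe_zpow]
  have h4 : ∫⁻ x, ‖trigSum f s (AddCircle.toCircle x)‖ₑ ^ 2
        ∂(AddCircle.haarAddCircle (T := (1 : ℝ))) =
      ∫⁻ x, ‖g x‖ₑ ^ 2 ∂AddCircle.haarAddCircle := by
    refine lintegral_congr_ae ?_
    filter_upwards [hcoe] with x hx
    rw [hx]
  rw [h4, ← hnorm, ENNReal.ofReal_pow (norm_nonneg _), Lp.norm_def,
    ENNReal.ofReal_toReal (Lp.eLpNorm_ne_top g),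
    eLpNorm_eq_lintegral_rpow_enorm_toReal (by norm_num) (by norm_num), ← ENNReal.rpow_natCast,
    ← ENNReal.rpow_mul]
  simp

theorem lintegral_Ioc_rpow {T a : ℝ} (hT : 0 ≤ T) (ha : 0 < a) :
    ∫⁻ t in Set.Ioc 0 T, ENNReal.ofReal (t ^ (a - 1)) = ENNReal.ofReal (T ^ a / a) := by
  have hi : IntervalIntegrable (fun t : ℝ => t ^ (a - 1)) volume 0 T :=
    intervalIntegral.intervalIntegrable_rpow' (by linarith)
  rw [← ofReal_integral_eq_lintegral_ofReal
      ((intervalIntegrable_iff_integrableOn_Ioc_of_le hT).1 hi),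
    ← intervalIntegral.integral_of_le hT, integral_rpow (Or.inl (by linarith)), sub_add_cancel,
    Real.zero_rpow ha.ne', sub_zero]
  filter_upwards [self_mem_ae_restrict measurableSet_Ioc] with t ht
  exact Real.rpow_nonneg ht.1.le _

/-- The distributional estimate for a trigonometric polynomial with normalized coefficients: the
coefficients larger than `(t / 2) ^ (-1 / (p - 1))` contribute at most `t / 2` uniformly, and the
smaller ones, which satisfy `t ≤ 2 * ‖f n‖ ^ (1 - p)`, are estimated in `L²`. -/
theorem measure_lt_norm_trigSum_le {p : ℝ} {f : ℤ → ℂ} {s : Finset ℤ}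
    (hf : ∑ n ∈ s, ‖f n‖ ^ p ≤ 1) {t : ℝ} (ht : 0 < t) :
    circleMeasure {z | t < ‖trigSum f s z‖} ≤ ∑ n ∈ s,
      if t ≤ 2 * ‖f n‖ ^ (1 - p) then ENNReal.ofReal (4 * ‖f n‖ ^ 2 * t ^ (-2 : ℝ)) else 0 := by
  classical
  set s₁ := s.filter fun n => t ≤ 2 * ‖f n‖ ^ (1 - p) ∧ f n ≠ 0 with hs₁
  have hlarge : ∀ z, ‖trigSum f s z‖ ≤ ‖trigSum f s₁ z‖ + t / 2 := by
    intro z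
    have h1 : trigSum f s z = trigSum f s₁ z +
        trigSum f (s.filter fun n => ¬ (t ≤ 2 * ‖f n‖ ^ (1 - p) ∧ f n ≠ 0)) z :=
      (Finset.sum_filter_add_sum_filter_not _ _ _).symm
    rw [h1]
    refine (norm_add_le _ _).trans (add_le_add_right ((norm_trigSum_le _ _ _).trans ?_) _)
    have h2 : ∀ n ∈ s.filter fun n => ¬ (t ≤ 2 * ‖f n‖ ^ (1 - p) ∧ f n ≠ 0),
        ‖f n‖ ≤ t / 2 * ‖f n‖ ^ p := by
      intro n hn
      rw [Finset.mem_filter] at hn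
      by_cases h0 : f n = 0
      · simp only [h0, norm_zero]
        positivity
      · have h3 : 2 * ‖f n‖ ^ (1 - p) < t := by
          by_contra! h
          exact hn.2 ⟨h, h0⟩
        have h4 : 0 < ‖f n‖ := norm_pos_iff.2 h0
        calc ‖f n‖ = ‖f n‖ ^ (1 - p) * ‖f n‖ ^ p := by
              rw [← Real.rpow_add h4]
              simp
          _ ≤ t / 2 * ‖f n‖ ^ p := by
              gcongr
              linarith
    refine (Finset.sum_le_sum h2).trans ?_
    rw [← Finset.mul_sum]
    have h5 : ∑ n ∈ s.filter (fun n => ¬ (t ≤ 2 * ‖f n‖ ^ (1 - p) ∧ f n ≠ 0)), ‖f n‖ ^ p ≤ 1 :=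
      (Finset.sum_le_sum_of_subset_of_nonneg (Finset.filter_subset _ _)
        fun _ _ _ => by positivity).trans hf
    nlinarith
  have hsub : {z | t < ‖trigSum f s z‖} ⊆
      {z | ENNReal.ofReal ((t / 2) ^ 2) ≤ ‖trigSum f s₁ z‖ₑ ^ 2} := by
    intro z hz
    have h1 := hlarge z
    have h2 : t / 2 ≤ ‖trigSum f s₁ z‖ := by
      rw [Set.mem_ofPred_eq] at hz
      linarith
    rw [Set.mem_ofPred_eq, ← ofReal_norm, ← ENNReal.ofReal_pow (norm_nonneg _)]
    exact ENNReal.ofReal_le_ofReal (by gcongr)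
  have hmarkov := mul_meas_ge_le_lintegral (μ := circleMeasure)
    ((continuous_trigSum f s₁).enorm.measurable.pow_const 2) (ENNReal.ofReal ((t / 2) ^ 2))
  rw [lintegral_enorm_trigSum_sq] at hmarkov
  have hpos : ENNReal.ofReal ((t / 2) ^ 2) ≠ 0 := by
    rw [Ne, ENNReal.ofReal_eq_zero, not_le]
    positivity
  calc circleMeasure {z | t < ‖trigSum f s z‖}
      ≤ circleMeasure {z | ENNReal.ofReal ((t / 2) ^ 2) ≤ ‖trigSum f s₁ z‖ₑ ^ 2} :=
        measure_mono hsub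
    _ ≤ ENNReal.ofReal (∑ n ∈ s₁, ‖f n‖ ^ 2) / ENNReal.ofReal ((t / 2) ^ 2) := by
        rw [ENNReal.le_div_iff_mul_le (Or.inl hpos) (Or.inl ENNReal.ofReal_ne_top), mul_comm]
        exact hmarkov
    _ = ∑ n ∈ s₁, ENNReal.ofReal (4 * ‖f n‖ ^ 2 * t ^ (-2 : ℝ)) := by
        rw [← ENNReal.ofReal_div_of_pos (by positivity),
          ← ENNReal.ofReal_sum_of_nonneg (fun _ _ => by positivity), ← Finset.sum_mul,
          ← Finset.mul_sum, Real.rpow_neg ht.le]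
        congr 1
        norm_cast
        field_simp
        norm_num
    _ ≤ _ := by
        rw [← Finset.sum_filter]
        refine Finset.sum_le_sum_of_subset fun n hn => ?_
        rw [hs₁, Finset.mem_filter] at hn
        exact Finset.mem_filter.2 ⟨hn.1, hn.2.1⟩

/-- The Hausdorff–Young inequality for coefficients of norm at most `1` in `ℓ^p`, by integrating the
distributional estimate. The constant blows up as `p → 2`, which is harmless here. -/
theorem lintegral_norm_trigSum_rpow_le {p q : ℝ} (hpq : p.HolderConjugate q) (hp2 : p < 2)
    {f : ℤ → ℂ} {s : Finset ℤ} (hf : ∑ n ∈ s, ‖f n‖ ^ p ≤ 1) :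
    ∫⁻ z, ENNReal.ofReal (‖trigSum f s z‖ ^ q) ∂circleMeasure ≤
      ENNReal.ofReal (q * (4 * 2 ^ (q - 2) / (q - 2))) := by
  have hp := hpq.lt
  have hq2 : 2 < q := by
    have h1 := hpq.mul_eq_add
    have h2 := hpq.symm.lt
    nlinarith
  have hq0 : 0 < q := by linarith
  rw [lintegral_rpow_eq_lintegral_meas_lt_mul circleMeasure (ae_of_all _ fun z => norm_nonneg _)
    (continuous_trigSum f s).norm.aemeasurable hq0, ENNReal.ofReal_mul hq0.le]
  gcongr
  calc ∫⁻ t in Set.Ioi 0, circleMeasure {z | t < ‖trigSum f s z‖} * ENNReal.ofReal (t ^ (q - 1))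
      ≤ ∫⁻ t in Set.Ioi 0, ∑ n ∈ s, (Set.Ioc 0 (2 * ‖f n‖ ^ (1 - p))).indicator
          (fun t => ENNReal.ofReal (4 * ‖f n‖ ^ 2) * ENNReal.ofReal (t ^ (q - 2 - 1))) t := by
        refine setLIntegral_mono' measurableSet_Ioi fun t ht => ?_
        have ht0 : (0 : ℝ) < t := ht
        refine (mul_le_mul_left (measure_lt_norm_trigSum_le hf ht) _).trans ?_
        rw [Finset.sum_mul]
        refine Finset.sum_le_sum fun n _ => ?_
        by_cases h : t ≤ 2 * ‖f n‖ ^ (1 - p)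
        · rw [if_pos h, Set.indicator_of_mem (Set.mem_Ioc.2 ⟨ht0, h⟩),
            ← ENNReal.ofReal_mul (by positivity), ← ENNReal.ofReal_mul (by positivity), mul_assoc,
            ← Real.rpow_add ht0]
          apply le_of_eq
          congr 3
          ring
        · rw [if_neg h, zero_mul]
          exact zero_le
    _ ≤ ∫⁻ t, ∑ n ∈ s, (Set.Ioc 0 (2 * ‖f n‖ ^ (1 - p))).indicator
          (fun t => ENNReal.ofReal (4 * ‖f n‖ ^ 2) * ENNReal.ofReal (t ^ (q - 2 - 1))) t :=
        setLIntegral_le_lintegral _ _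
    _ = ∑ n ∈ s, ENNReal.ofReal (4 * ‖f n‖ ^ 2) *
          ENNReal.ofReal ((2 * ‖f n‖ ^ (1 - p)) ^ (q - 2) / (q - 2)) := by
        rw [lintegral_finsetSum]
        · refine Finset.sum_congr rfl fun n _ => ?_
          rw [lintegral_indicator measurableSet_Ioc, lintegral_const_mul _ (by fun_prop),
            lintegral_Ioc_rpow (by positivity) (by linarith)]
        · intro n _
          exact Measurable.indicator (by fun_prop) measurableSet_Ioc
    _ = ∑ n ∈ s, ENNReal.ofReal (4 * 2 ^ (q - 2) / (q - 2)) * ENNReal.ofReal (‖f n‖ ^ p) := by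
        refine Finset.sum_congr rfl fun n _ => ?_
        have hq2' : 0 < q - 2 := by linarith
        rw [← ENNReal.ofReal_mul (by positivity), ← ENNReal.ofReal_mul (by positivity)]
        congr 1
        rcases (norm_nonneg (f n)).eq_or_lt with h | h
        · rw [← h, Real.zero_rpow (show p ≠ 0 by linarith)]
          simp
        · rw [Real.mul_rpow (by norm_num) (by positivity), ← Real.rpow_mul h.le,
            show (1 - p) * (q - 2) = p - 2 by linarith [hpq.mul_eq_add],
            show ‖f n‖ ^ p = ‖f n‖ ^ 2 * ‖f n‖ ^ (p - 2) by
              rw [← Real.rpow_natCast, ← Real.rpow_add h]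
              norm_num]
          ring
    _ ≤ ENNReal.ofReal (4 * 2 ^ (q - 2) / (q - 2)) := by
        rw [← Finset.mul_sum, ← ENNReal.ofReal_sum_of_nonneg fun _ _ => by positivity]
        refine mul_le_of_le_one_right zero_le ?_
        exact ENNReal.ofReal_le_one.2 hf

/-- The Hausdorff–Young inequality for trigonometric polynomials, with a non-optimal constant, for
`1 ≤ p < 2`. -/
theorem exists_eLpNorm_trigSum_le {p : ℝ≥0∞} (hp1 : 1 ≤ p) (hp2 : p < 2) :
    ∃ A : ℝ, 0 ≤ A ∧ ∀ (f : ℤ → ℂ) (s : Finset ℤ),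
      eLpNorm (trigSum f s) (ENNReal.conjExponent p) circleMeasure ≤
        ENNReal.ofReal (A * (∑ n ∈ s, ‖f n‖ ^ p.toReal) ^ (1 / p.toReal)) := by
  have hptop : p ≠ ∞ := (hp2.trans (by norm_num)).ne
  rcases hp1.eq_or_lt with rfl | hp1
  · refine ⟨1, zero_le_one, fun f s => ?_⟩
    have h1 : ENNReal.conjExponent 1 = ∞ := by simp [ENNReal.conjExponent]
    rw [h1, eLpNorm_exponent_top]
    refine (eLpNormEssSup_le_of_ae_bound (ae_of_all _ (norm_trigSum_le f s))).trans ?_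
    simp
  · have hc : p.HolderConjugate (ENNReal.conjExponent p) :=
      ENNReal.HolderConjugate.conjExponent hp1.le
    have hcR : p.toReal.HolderConjugate (ENNReal.conjExponent p).toReal :=
      ENNReal.HolderConjugate.toReal ((ENNReal.toReal_lt_toReal ENNReal.one_ne_top hptop).2 hp1)
    set P := p.toReal with hP
    set q := (ENNReal.conjExponent p).toReal with hq
    have hqtop : ENNReal.conjExponent p ≠ ∞ := by
      simpa [ENNReal.conjExponent] using (tsub_pos_of_lt hp1).ne'
    have hP2 : P < 2 := by
      rw [hP]
      exact (ENNReal.toReal_lt_toReal hptop (by norm_num)).2 hp2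
    have hP0 : 0 < P := hcR.pos
    have hq0 : 0 < q := hcR.symm.pos
    set A₀ := q * (4 * 2 ^ (q - 2) / (q - 2)) with hA₀
    refine ⟨|A₀| ^ (1 / q), by positivity, fun f s => ?_⟩
    set D := ∑ n ∈ s, ‖f n‖ ^ P with hD
    have hD0 : 0 ≤ D := Finset.sum_nonneg fun _ _ => by positivity
    rcases hD0.eq_or_lt with hD0 | hD0
    · have h1 : trigSum f s = 0 := by
        funext z
        refine Finset.sum_eq_zero fun n hn => ?_
        have h2 := (Finset.sum_eq_zero_iff_of_nonneg (fun _ _ => by positivity)).1 hD0.symm n hn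
        rw [Real.rpow_eq_zero (norm_nonneg _) hP0.ne', norm_eq_zero] at h2
        rw [h2, zero_mul]
      rw [h1, eLpNorm_zero]
      exact zero_le
    · set c : ℝ := D ^ (1 / P) with hc
      have hc0 : 0 < c := by positivity
      have hcP : c ^ P = D := by
        rw [hc, ← Real.rpow_mul hD0.le, one_div_mul_cancel hP0.ne', Real.rpow_one]
      set g : ℤ → ℂ := fun n => (c : ℂ)⁻¹ * f n with hg
      have hgn : ∑ n ∈ s, ‖g n‖ ^ P ≤ 1 := by
        have : ∀ n ∈ s, ‖g n‖ ^ P = D⁻¹ * ‖f n‖ ^ P := fun n _ => by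
          rw [hg, norm_mul, Real.mul_rpow (norm_nonneg _) (norm_nonneg _), norm_inv,
            Complex.norm_of_nonneg hc0.le, Real.inv_rpow hc0.le, hcP]
        rw [Finset.sum_congr rfl this, ← Finset.mul_sum, ← hD, inv_mul_cancel₀ hD0.ne']
      have hfg : trigSum f s = c • trigSum g s := by
        funext z
        simp only [trigSum, Pi.smul_apply, Finset.smul_sum, hg, Complex.real_smul]
        refine Finset.sum_congr rfl fun n _ => ?_
        have : (c : ℂ) ≠ 0 := by exact_mod_cast hc0.ne'
        field_simp
      have key := lintegral_norm_trigSum_rpow_le hcR hP2 hgn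
      rw [hfg, eLpNorm_const_smul, Real.enorm_eq_ofReal hc0.le, mul_comm,
        ENNReal.ofReal_mul (by positivity)]
      gcongr
      rw [eLpNorm_eq_lintegral_rpow_enorm_toReal (by simp [ENNReal.conjExponent]) hqtop, ← hq,
        ← ENNReal.ofReal_rpow_of_nonneg (abs_nonneg _) (by positivity)]
      gcongr
      refine le_trans (le_of_eq ?_) (key.trans (ENNReal.ofReal_le_ofReal (le_abs_self _)))
      refine lintegral_congr fun z => ?_
      rw [← ofReal_norm, ENNReal.ofReal_rpow_of_nonneg (norm_nonneg _) hq0.le]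

/-! ### Transfer matrices -/

theorem opNorm_nonneg (A : Matrix (Fin 2) (Fin 2) ℂ) : 0 ≤ opNorm A := norm_nonneg _

theorem continuous_toEuclideanCLM :
    Continuous (Matrix.toEuclideanCLM (n := Fin 2) (𝕜 := ℂ)) :=
  LinearMap.continuous_of_finiteDimensional
    (Matrix.toEuclideanCLM (n := Fin 2) (𝕜 := ℂ)).toAlgEquiv.toLinearMap

theorem continuous_opNorm : Continuous opNorm :=
  continuous_norm.comp continuous_toEuclideanCLM

theorem continuous_toEuclideanCLM_symm :
    Continuous (Matrix.toEuclideanCLM (n := Fin 2) (𝕜 := ℂ)).symm :=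
  LinearMap.continuous_of_finiteDimensional
    (Matrix.toEuclideanCLM (n := Fin 2) (𝕜 := ℂ)).symm.toAlgEquiv.toLinearMap

/-- The Hermitian matrix with zero diagonal and upper right entry `w`; these matrices are the
tangent directions of `SU(1,1)` that occur as logarithms of transfer matrices. -/
def offDiag (w : ℂ) : Matrix (Fin 2) (Fin 2) ℂ := !![0, w; conj w, 0]

theorem offDiag_add (v w : ℂ) : offDiag v + offDiag w = offDiag (v + w) := by
  simp [offDiag]

theorem offDiag_ofReal_mul (t : ℝ) (w : ℂ) : offDiag (t * w) = (t : ℂ) • offDiag w := by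
  simp [offDiag]

theorem opNorm_offDiag_le (w : ℂ) : opNorm (offDiag w) ≤ ‖w‖ := by
  refine ContinuousLinearMap.opNorm_le_bound _ (norm_nonneg _) fun v => ?_
  rw [EuclideanSpace.norm_eq, EuclideanSpace.norm_eq]
  apply Real.sqrt_le_iff.2 ⟨by positivity, ?_⟩
  rw [mul_pow, Real.sq_sqrt (by positivity)]
  simp only [Fin.sum_univ_two, Matrix.ofLp_toEuclideanCLM, Matrix.mulVec, dotProduct, offDiag]
  simp [mul_pow]
  apply le_of_eq
  ring

/-- The coefficient of the linearization: the transfer matrix of `F` at `n` is the exponential of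
`offDiag (coeff F n * z ^ n)`. -/
noncomputable def coeff (F : ℤ → ℂ) (n : ℤ) : ℂ := (Real.artanh ‖F n‖ : ℂ) * (F n / ‖F n‖)

theorem norm_coeff (F : ℤ → ℂ) (n : ℤ) : ‖coeff F n‖ = Real.artanh ‖F n‖ := by
  rw [coeff, norm_mul, Complex.norm_of_nonneg (Real.artanh_nonneg (norm_nonneg _))]
  rcases eq_or_ne (F n) 0 with h | h
  · simp [h]
  · have : ‖F n‖ ≠ 0 := norm_ne_zero_iff.2 h
    rw [norm_div, Complex.norm_real, norm_norm, div_self this, mul_one]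

theorem conj_coe_zpow (z : Circle) (n : ℤ) : conj ((z : ℂ) ^ n) = (z : ℂ) ^ (-n) := by
  rw [map_zpow₀, ← Circle.coe_inv_eq_conj, Circle.coe_inv, inv_zpow, zpow_neg]

/-- The explicit form of `exp W`, where `W = offDiag (coeff F n * z ^ n)` has norm
`artanh ‖F n‖`. -/
theorem transfer_eq {F : ℤ → ℂ} {n : ℤ} (hF : ‖F n‖ < 1) (z : Circle) :
    transfer F n z = (Real.cosh (Real.artanh ‖F n‖) : ℂ) • (1 : Matrix (Fin 2) (Fin 2) ℂ) +
      (Real.sinh (Real.artanh ‖F n‖) : ℂ) • offDiag (F n / ‖F n‖ * (z : ℂ) ^ n) := by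
  have h0 : ‖F n‖ ∈ Set.Ioo (-1) 1 := ⟨by linarith [norm_nonneg (F n)], hF⟩
  rw [Real.cosh_artanh h0, Real.sinh_artanh h0]
  rcases eq_or_ne (F n) 0 with h | h
  · simp [transfer, h, offDiag, Matrix.one_fin_two]
  · have h1 : (‖F n‖ : ℂ) ≠ 0 := by exact_mod_cast norm_ne_zero_iff.2 h
    have h2 := conj_coe_zpow z n
    ext i j
    fin_cases i <;> fin_cases j <;> simp [transfer, offDiag, h2] <;> field_simp

theorem opNorm_cosh_add_sinh_sub_one_le {t : ℝ} (ht : 0 ≤ t) {v : ℂ} (hv : ‖v‖ ≤ 1) :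
    opNorm ((Real.cosh t : ℂ) • (1 : Matrix (Fin 2) (Fin 2) ℂ) +
      (Real.sinh t : ℂ) • offDiag v - 1) ≤ Real.exp t - 1 := by
  have e : (Real.cosh t : ℂ) • (1 : Matrix (Fin 2) (Fin 2) ℂ) + (Real.sinh t : ℂ) • offDiag v - 1 =
      ((Real.cosh t - 1 : ℝ) : ℂ) • (1 : Matrix (Fin 2) (Fin 2) ℂ) +
        (Real.sinh t : ℂ) • offDiag v := by
    push_cast
    module
  rw [e, opNorm, map_add, map_smul, map_smul]
  refine (norm_add_le _ _).trans ?_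
  rw [norm_smul, norm_smul, map_one, norm_one, Complex.norm_of_nonneg (Real.sinh_nonneg_iff.2 ht),
    Complex.norm_of_nonneg (by linarith [Real.one_le_cosh t]), ← Real.cosh_add_sinh]
  have h1 := (opNorm_offDiag_le v).trans hv
  rw [opNorm] at h1
  have h2 := Real.sinh_nonneg_iff.2 ht
  nlinarith

theorem opNorm_cosh_add_sinh_sub_one_sub_le {t : ℝ} (ht : 0 ≤ t) (ht1 : t ≤ 1) {v : ℂ}
    (hv : ‖v‖ ≤ 1) :
    opNorm ((Real.cosh t : ℂ) • (1 : Matrix (Fin 2) (Fin 2) ℂ) + (Real.sinh t : ℂ) • offDiag v - 1 -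
      offDiag (t * v)) ≤ t ^ 2 := by
  have e : (Real.cosh t : ℂ) • (1 : Matrix (Fin 2) (Fin 2) ℂ) + (Real.sinh t : ℂ) • offDiag v - 1 -
      offDiag (t * v) = ((Real.cosh t - 1 : ℝ) : ℂ) • (1 : Matrix (Fin 2) (Fin 2) ℂ) +
        ((Real.sinh t - t : ℝ) : ℂ) • offDiag v := by
    rw [offDiag_ofReal_mul]
    push_cast
    module
  have h3 : 0 ≤ Real.sinh t - t := by linarith [Real.self_le_sinh_iff.2 ht]
  rw [e, opNorm, map_add, map_smul, map_smul]
  refine (norm_add_le _ _).trans ?_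
  rw [norm_smul, norm_smul, map_one, norm_one, Complex.norm_of_nonneg h3,
    Complex.norm_of_nonneg (by linarith [Real.one_le_cosh t])]
  have h1 := (opNorm_offDiag_le v).trans hv
  rw [opNorm] at h1
  have h4 := Real.abs_exp_sub_one_sub_id_le (x := t) (by rwa [abs_of_nonneg ht])
  rw [← Real.cosh_add_sinh] at h4
  have h5 := le_abs_self (Real.cosh t + Real.sinh t - 1 - t)
  nlinarith

theorem transferProd_of_lt (F : ℤ → ℂ) {M N : ℤ} (h : N < M) (z : Circle) :
    transferProd F M N z = 1 := by
  rw [transferProd, show (N + 1 - M).toNat = 0 by omega]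
  rfl

theorem transferProd_self (F : ℤ → ℂ) (M : ℤ) (z : Circle) :
    transferProd F M M z = transfer F M z := by
  rw [transferProd, show (M + 1 - M).toNat = 1 by omega]
  simp

theorem transferProd_mul (F : ℤ → ℂ) {a b c : ℤ} (hab : a ≤ b + 1) (hbc : b ≤ c) (z : Circle) :
    transferProd F a b z * transferProd F (b + 1) c z = transferProd F a c z := by
  simp only [transferProd]
  rw [show (c + 1 - a).toNat = (b + 1 - a).toNat + (c + 1 - (b + 1)).toNat by omega,
    List.range_add, List.map_append, List.prod_append, List.map_map]
  congr 3
  funext k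
  simp only [Function.comp_apply]
  congr 1
  push_cast
  omega

theorem continuous_transfer (F : ℤ → ℂ) (n : ℤ) : Continuous (transfer F n) := by
  refine continuous_matrix fun i j => ?_
  have h1 := continuous_coe_zpow n
  have h2 := continuous_coe_zpow (-n)
  fin_cases i <;> fin_cases j <;> simp [transfer, -zpow_neg] <;> fun_prop

theorem continuous_transferProd (F : ℤ → ℂ) (M N : ℤ) : Continuous (transferProd F M N) :=
  by
  unfold transferProd
  exact continuous_list_prod _ fun k _ => continuous_transfer F (M + (k : ℤ))

/-! ### The group `SU(1,1)` -/

theorem one_mem_SU11 : (1 : Matrix (Fin 2) (Fin 2) ℂ) ∈ SU11 :=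
  ⟨1, 0, by simp, by simp [Matrix.one_fin_two]⟩

theorem mul_mem_SU11 {A B : Matrix (Fin 2) (Fin 2) ℂ} (hA : A ∈ SU11) (hB : B ∈ SU11) :
    A * B ∈ SU11 := by
  obtain ⟨a, b, h1, rfl⟩ := hA
  obtain ⟨c, d, h2, rfl⟩ := hB
  refine ⟨a * c + b * conj d, a * d + b * conj c, ?_, ?_⟩
  · apply Complex.ofReal_injective
    replace h1 := congrArg (fun x : ℝ => (x : ℂ)) h1
    replace h2 := congrArg (fun x : ℝ => (x : ℂ)) h2
    push_cast [← Complex.conj_mul'] at h1 h2 ⊢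
    simp only [map_add, map_mul, Complex.conj_conj]
    linear_combination (conj c * c - conj d * d) * h1 + h2
  · simp
    constructor <;> ring

theorem transfer_mem_SU11 {F : ℤ → ℂ} {n : ℤ} (hF : ‖F n‖ < 1) (z : Circle) :
    transfer F n z ∈ SU11 := by
  have h0 : 0 < 1 - ‖F n‖ ^ 2 := by nlinarith [norm_nonneg (F n)]
  set c : ℝ := (Real.sqrt (1 - ‖F n‖ ^ 2))⁻¹ with hc
  have hc2 : c ^ 2 * (1 - ‖F n‖ ^ 2) = 1 := by
    rw [hc, inv_pow, Real.sq_sqrt h0.le, inv_mul_cancel₀ h0.ne']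
  refine ⟨c, c * (F n * (z : ℂ) ^ n), ?_, ?_⟩
  · rw [norm_mul, norm_mul, norm_coe_zpow, Complex.norm_real, Real.norm_eq_abs, mul_pow, sq_abs]
    linear_combination hc2
  · have h2 := conj_coe_zpow z n
    rw [transfer, ← hc]
    simp [h2]

theorem transferProd_mem_SU11 {F : ℤ → ℂ} (hF : ∀ n, ‖F n‖ < 1) (M N : ℤ) (z : Circle) :
    transferProd F M N z ∈ SU11 := by
  rw [transferProd]
  generalize List.range (N + 1 - M).toNat = l
  induction l with
  | nil => exact one_mem_SU11
  | cons k l ih =>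
    rw [List.map_cons, List.prod_cons]
    exact mul_mem_SU11 (transfer_mem_SU11 (hF _) z) ih

theorem mem_SU11_iff {A : Matrix (Fin 2) (Fin 2) ℂ} :
    A ∈ SU11 ↔ ‖A 0 0‖ ^ 2 - ‖A 0 1‖ ^ 2 = 1 ∧ A 1 0 = conj (A 0 1) ∧ A 1 1 = conj (A 0 0) := by
  constructor
  · rintro ⟨a, b, h, rfl⟩
    simpa using h
  · rintro ⟨h1, h2, h3⟩
    refine ⟨A 0 0, A 0 1, h1, ?_⟩
    rw [← h2, ← h3]
    exact A.eta_fin_two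

theorem isClosed_SU11 : IsClosed SU11 := by
  have h : SU11 = {A : Matrix (Fin 2) (Fin 2) ℂ | ‖A 0 0‖ ^ 2 - ‖A 0 1‖ ^ 2 = 1} ∩
      ({A | A 1 0 = conj (A 0 1)} ∩ {A | A 1 1 = conj (A 0 0)}) := by
    ext A
    exact mem_SU11_iff
  have c : ∀ i j, Continuous fun A : Matrix (Fin 2) (Fin 2) ℂ => A i j := fun i j =>
    continuous_id.matrix_elem i j
  rw [h]
  refine (isClosed_eq ?_ continuous_const).inter
    ((isClosed_eq (c 1 0) ?_).inter (isClosed_eq (c 1 1) ?_))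
  · exact ((c 0 0).norm.pow 2).sub ((c 0 1).norm.pow 2)
  · exact Complex.continuous_conj.comp (c 0 1)
  · exact Complex.continuous_conj.comp (c 0 0)

theorem isUnit_det_of_mem_SU11 {A : Matrix (Fin 2) (Fin 2) ℂ} (hA : A ∈ SU11) :
    IsUnit A.det := by
  obtain ⟨a, b, h, rfl⟩ := hA
  replace h := congrArg (fun x : ℝ => (x : ℂ)) h
  push_cast [← Complex.mul_conj'] at h
  rw [Matrix.det_fin_two_of, h]
  exact isUnit_one

/-! ### The curve controlled by its linearization -/

theorem sum_Ico_add_sum_Ico {A : Type*} [AddCommMonoid A] (g : ℤ → A) {a b c : ℤ} (hab : a ≤ b)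
    (hbc : b ≤ c) :
    ∑ n ∈ Finset.Ico a b, g n + ∑ n ∈ Finset.Ico b c, g n = ∑ n ∈ Finset.Ico a c, g n := by
  rw [← Finset.sum_union (Finset.Ico_disjoint_Ico_consecutive a b c),
    Finset.Ico_union_Ico_eq_Ico hab hbc]

theorem trigSum_Ico_add_trigSum_Ico (f : ℤ → ℂ) {a b c : ℤ} (hab : a ≤ b) (hbc : b ≤ c)
    (z : Circle) : trigSum f (Finset.Ico a b) z + trigSum f (Finset.Ico b c) z =
      trigSum f (Finset.Ico a c) z :=
  sum_Ico_add_sum_Ico (fun n => f n * (z : ℂ) ^ n) hab hbc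

theorem trigSum_Ico_succ (f : ℤ → ℂ) (n : ℤ) (z : Circle) :
    trigSum f (Finset.Ico n (n + 1)) z = f n * (z : ℂ) ^ n := by
  have h : Finset.Ico n (n + 1) = {n} := by
    ext k
    simp only [Finset.mem_Ico, Finset.mem_singleton]
    omega
  rw [h, trigSum, Finset.sum_singleton]

/-- Lyons' estimate for transfer matrices: a control of the partial sums of the linear Fourier
series controls the increments of the nonlinear curve. The single steps are handled by
`‖T - 1‖ ≤ exp t - 1` and `‖T - 1 - W‖ ≤ exp t - 1 - t`, where `T = exp W` and `‖W‖ = t`. -/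
theorem exists_log_one_add_opNorm_transferProd_le {s : ℝ} (hs1 : 1 ≤ s) (hs2 : s < 2) :
    ∃ C : ℝ, 1 ≤ C ∧ ∀ (F : ℤ → ℂ) (z : Circle) (ω : ℤ → ℤ → ℝ) (lo hi : ℤ),
      (∀ n, ‖F n‖ < 1) → IsControl ω →
      (∀ a b, lo ≤ a → a ≤ b → b ≤ hi →
        ‖trigSum (coeff F) (Finset.Ico a b) z‖ ≤ ω a b ^ (1 / s)) →
      ∀ a b, lo ≤ a → a ≤ b → b ≤ hi →
        Real.log (1 + opNorm (transferProd F a (b - 1) z - 1)) ≤ C * (ω a b ^ (1 / s) + ω a b) := by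
  have hs0 : 0 < s := by linarith
  obtain ⟨C, hC1, hC⟩ := exists_log_one_add_norm_sub_one_le (α := 1 / s)
    (one_div_lt_one_div_of_lt hs0 hs2) ((div_le_one hs0).2 hs1)
  refine ⟨C, hC1, ?_⟩
  intro F z ω lo hi hF hω hS a b ha hab hb
  set Φ := Matrix.toEuclideanCLM (n := Fin 2) (𝕜 := ℂ) with hΦ
  have hjump : ∀ n, lo ≤ n → n + 1 ≤ hi → Real.artanh ‖F n‖ ≤ ω n (n + 1) ^ (1 / s) := by
    intro n h1 h2
    have h3 := hS n (n + 1) h1 (by omega) h2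
    rwa [trigSum_Ico_succ, norm_mul, norm_coe_zpow, mul_one, norm_coeff] at h3
  have hv : ∀ n, ‖F n / ‖F n‖ * (z : ℂ) ^ n‖ ≤ 1 := fun n => by
    rw [norm_mul, norm_coe_zpow, mul_one, norm_div, Complex.norm_real, norm_norm]
    exact div_self_le_one _
  have ht : ∀ n, 0 ≤ Real.artanh ‖F n‖ := fun n => Real.artanh_nonneg (norm_nonneg _)
  have hstep : ∀ n : ℤ, transferProd F n (n + 1 - 1) z = transfer F n z := fun n => by
    rw [add_sub_cancel_right, transferProd_self]
  have key := hC (fun a b => Φ (transferProd F a (b - 1) z))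
    (fun a b => Φ (offDiag (trigSum (coeff F) (Finset.Ico a b) z))) ω lo hi hω ?_ ?_ ?_ ?_ ?_ ?_
    a b ha hab hb
  · rwa [← map_one Φ, ← map_sub] at key
  · intro a
    rw [transferProd_of_lt F (by omega), map_one]
  · intro a b c h1 h2
    have := transferProd_mul F (a := a) (b := b - 1) (c := c - 1) (by omega) (by omega) z
    rw [sub_add_cancel] at this
    rw [← map_mul, this]
  · intro a b c h1 h2
    rw [← map_add, offDiag_add, trigSum_Ico_add_trigSum_Ico _ h1 h2]
  · intro a b h1 h2 h3
    exact (opNorm_offDiag_le _).trans (hS a b h1 h2 h3)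
  · intro n h1 h2 h3
    have h4 := hjump n h1 h2
    have h5 : ω n (n + 1) ^ (1 / s) ≤ 1 := Real.rpow_le_one (hω.nonneg _ _) h3 (by positivity)
    have h6 : trigSum (coeff F) (Finset.Ico n (n + 1)) z =
        (Real.artanh ‖F n‖ : ℂ) * (F n / ‖F n‖ * (z : ℂ) ^ n) := by
      rw [trigSum_Ico_succ, coeff, mul_assoc]
    have h7 := opNorm_cosh_add_sinh_sub_one_sub_le (ht n) (h4.trans h5) (hv n)
    rw [← transfer_eq (hF n), opNorm, map_sub, map_sub, map_one] at h7
    rw [hstep, h6]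
    refine h7.trans ?_
    have := ht n
    gcongr
  · intro n h1 h2
    have h7 := opNorm_cosh_add_sinh_sub_one_le (ht n) (hv n)
    rw [← transfer_eq (hF n), opNorm, map_sub, map_one] at h7
    rw [hstep]
    refine le_trans ?_ (hjump n h1 h2)
    rw [Real.log_le_iff_le_exp (by positivity)]
    linarith

/-! ### A pointwise majorant for the variation -/

/-- Fatou's lemma in `L^q`, including `q = ∞`. -/
theorem eLpNorm_liminf_le {X : Type*} [MeasurableSpace X] {ν : Measure X} {q b : ℝ≥0∞}
    {U : ℕ → X → ℝ≥0∞} (hq : q ≠ 0) (hU : ∀ n, Measurable (U n))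
    (h : ∀ n, eLpNorm (U n) q ν ≤ b) :
    eLpNorm (fun x => liminf (fun n => U n x) atTop) q ν ≤ b := by
  by_cases hqt : q = ∞
  · subst hqt
    simp only [eLpNorm_exponent_top] at h ⊢
    have h1 : ∀ᵐ x ∂ν, ∀ n, U n x ≤ b := ae_all_iff.2 fun n => by
      filter_upwards [ae_le_eLpNormEssSup (f := U n) (μ := ν)] with x hx
      exact le_trans (by simpa using hx) (h n)
    refine eLpNormEssSup_le_of_ae_enorm_bound ?_
    filter_upwards [h1] with x hx
    rw [enorm_eq_self]
    exact (liminf_le_liminf (Eventually.of_forall hx)).trans (by simp)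
  · have hq0 : 0 < q.toReal := ENNReal.toReal_pos hq hqt
    have hb : ∀ n, ∫⁻ x, U n x ^ q.toReal ∂ν ≤ b ^ q.toReal := fun n => by
      have h1 := h n
      rw [eLpNorm_eq_lintegral_rpow_enorm_toReal hq hqt, one_div,
        ENNReal.rpow_inv_le_iff hq0] at h1
      simpa using h1
    rw [eLpNorm_eq_lintegral_rpow_enorm_toReal hq hqt, one_div, ENNReal.rpow_inv_le_iff hq0]
    have h2 : ∀ x, ‖liminf (fun n => U n x) atTop‖ₑ ^ q.toReal =
        liminf (fun n => U n x ^ q.toReal) atTop := fun x => by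
      rw [enorm_eq_self]
      exact (ENNReal.monotone_rpow_of_nonneg hq0.le).map_liminf_of_continuousAt _
        ENNReal.continuous_rpow_const.continuousAt
    simp only [h2]
    refine (lintegral_liminf_le fun n => (hU n).pow_const _).trans ?_
    exact (liminf_le_liminf (Eventually.of_forall hb)).trans (by simp)

/-- The distance of `γ[F](M; z)` and `γ[F](N; z)`, expressed by a finite product. -/
noncomputable def logDist (F : ℤ → ℂ) (z : Circle) (M N : ℤ) : ℝ :=
  Real.log (1 + opNorm (transferProd F (M + 1) N z - 1))

theorem logDist_nonneg (F : ℤ → ℂ) (z : Circle) (M N : ℤ) : 0 ≤ logDist F z M N :=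
  Real.log_nonneg (by linarith [opNorm_nonneg (transferProd F (M + 1) N z - 1)])

/-- The sum of `s`-th powers of the increments `δ` along a finite sequence; its supremum over
increasing sequences is the `s`-th power of the `s`-variation. -/
noncomputable def varSum (δ : ℤ → ℤ → ℝ) (s : ℝ) {K : ℕ} (N : Fin (K + 1) → ℤ) : ℝ≥0∞ :=
  ∑ j : Fin K, ENNReal.ofReal (δ (N j.castSucc) (N j.succ)) ^ s

theorem sum_norm_coeff_rpow_le {p : ℝ≥0∞} (hp0 : p ≠ 0) (hp : p ≠ ∞) {F : ℤ → ℂ}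
    (hF : ∀ n, ‖F n‖ < 1) (s : Finset ℤ) :
    ENNReal.ofReal ((∑ n ∈ s, ‖coeff F n‖ ^ p.toReal) ^ (1 / p.toReal)) ≤ logNorm p F := by
  have hp0' := ENNReal.toReal_pos hp0 hp
  rw [logNorm, eLpNorm_eq_lintegral_rpow_enorm_toReal hp0 hp, lintegral_count,
    ← ENNReal.ofReal_rpow_of_nonneg (Finset.sum_nonneg fun _ _ => by positivity) (by positivity),
    ENNReal.ofReal_sum_of_nonneg fun _ _ => by positivity]
  gcongr
  refine (Finset.sum_le_sum fun n _ => ?_).trans (ENNReal.sum_le_tsum s)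
  rw [norm_coeff, ← ofReal_norm, ENNReal.ofReal_rpow_of_nonneg (norm_nonneg _) hp0'.le]
  have h0 := norm_nonneg (F n)
  have h1 := Real.artanh_nonneg h0
  gcongr
  rw [Real.artanh_eq_half_log ⟨by linarith, (hF n).le⟩] at h1 ⊢
  rw [Real.norm_of_nonneg (by linarith)]
  linarith

/-- The variation of the nonlinear curve is bounded pointwise by `C * (U + U ^ s)`, where `U`
satisfies the linear Hausdorff–Young bound. The majorant `U` is the lower limit, as `n → ∞`, of the `1 / s`-th
powers of the total masses of the controls on `[-n, n)`; these controls are built from different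
trees and need not be monotone in `n`. -/
theorem exists_logDist_majorant {p : ℝ≥0∞} (hp1 : 1 ≤ p) (hp2 : p < 2) {s : ℝ}
    (hps : p.toReal < s) (hs2 : s < 2) :
    ∃ C A : ℝ≥0, 1 ≤ C ∧ ∀ F : ℤ → ℂ, (∀ n, ‖F n‖ < 1) → ∃ U : Circle → ℝ≥0∞,
      Measurable U ∧ eLpNorm U (ENNReal.conjExponent p) circleMeasure ≤ A * logNorm p F ∧
      ∀ (z : Circle) (K : ℕ) (N : Fin (K + 1) → ℤ), StrictMono N →
        varSum (logDist F z) s N ≤ (C * (U z + U z ^ s)) ^ s := by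
  have hptop : p ≠ ∞ := (hp2.trans (by norm_num)).ne
  have hpz : p ≠ 0 := (zero_lt_one.trans_le hp1).ne'
  set P := p.toReal with hP
  have hP1 : 1 ≤ P := by
    rw [hP, ← ENNReal.toReal_one]
    exact ENNReal.toReal_mono hptop hp1
  have hP0 : 0 < P := by linarith
  have hs1 : 1 < s := by linarith
  have hs0 : 0 < s := by linarith
  obtain ⟨C, hC1, hC⟩ := exists_log_one_add_opNorm_transferProd_le hs1.le hs2
  obtain ⟨A, hA0, hA⟩ := exists_eLpNorm_trigSum_le hp1 hp2
  obtain ⟨C₀, B, hC₀, hB, hCB⟩ := exists_dominating_control hs1.le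
    (show 1 < s / P from (one_lt_div hP0).2 hps)
  set q := ENNReal.conjExponent p with hq
  have hq0 : q ≠ 0 := by simp [hq, ENNReal.conjExponent]
  have hsq : ENNReal.ofReal s ≠ 0 := by simpa using hs0
  have hqs : q / ENNReal.ofReal s * ENNReal.ofReal s = q :=
    ENNReal.div_mul_cancel hsq ENNReal.ofReal_ne_top
  have hq2 : 2 ≤ q := by
    rw [hq, ENNReal.conjExponent, show (2 : ℝ≥0∞) = 1 + 1 by norm_num]
    gcongr
    rw [ENNReal.one_le_inv]
    refine tsub_le_iff_right.2 (hp2.le.trans (by norm_num))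
  have hq1 : 1 ≤ q / ENNReal.ofReal s := by
    rw [ENNReal.le_div_iff_mul_le (Or.inl hsq) (Or.inl ENNReal.ofReal_ne_top), one_mul]
    refine le_trans ?_ hq2
    simpa using ENNReal.ofReal_le_ofReal hs2.le
  refine ⟨C.toNNReal, ((C₀ * B) ^ (1 / s) * A).toNNReal, ?_, ?_⟩
  · rw [← Real.toNNReal_one]
    exact Real.toNNReal_le_toNNReal hC1
  intro F hF
  set S : ℤ → ℤ → Circle → ℂ := fun a b => trigSum (coeff F) (Finset.Ico a b) with hS
  set D : ℤ → ℤ → ℝ := fun a b => ∑ n ∈ Finset.Ico a b, ‖coeff F n‖ ^ P with hD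
  have hD0 : ∀ a b, 0 ≤ D a b := fun a b => Finset.sum_nonneg fun _ _ => by positivity
  have hμ : IsControl fun a b => A ^ P * D a b :=
    ⟨fun a b => by have := hD0 a b; positivity, fun a b c h1 h2 => by
      rw [← mul_add, hD, sum_Ico_add_sum_Ico _ h1 h2]⟩
  have hrpow : ∀ x : ℝ, 0 ≤ x → (A ^ P * x) ^ (s / P) = (A * x ^ (1 / P)) ^ s := fun x hx => by
    have h1 : A * x ^ (1 / P) = (A ^ P * x) ^ (1 / P) := by
      rw [Real.mul_rpow (by positivity) hx, ← Real.rpow_mul hA0, mul_one_div_cancel hP0.ne',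
        Real.rpow_one]
    rw [h1, ← Real.rpow_mul (by positivity)]
    congr 1
    ring
  have hnorm : ∀ a b, a ≤ b → eLpNorm (fun x => ‖S a b x‖ ^ s) (q / ENNReal.ofReal s)
      circleMeasure ≤ ENNReal.ofReal ((A ^ P * D a b) ^ (s / P)) := fun a b _ => by
    have h1 := hD0 a b
    rw [eLpNorm_norm_rpow _ hs0, hqs, hrpow _ h1,
      ← ENNReal.ofReal_rpow_of_nonneg (by positivity) hs0.le]
    gcongr
    exact hA _ _
  have hex := fun n : ℕ => hCB circleMeasure (q / ENNReal.ofReal s) S _ hq1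
    (fun a b => (continuous_trigSum _ _).measurable)
    (fun a b c x h1 h2 => trigSum_Ico_add_trigSum_Ico _ h1 h2 x) hμ hnorm (-(n : ℤ)) n (by omega)
  choose ω hω hωm hωS hωn using hex
  set V : ℕ → Circle → ℝ := fun n z => C₀ * ω n z (-(n : ℤ)) n with hV
  have hV0 : ∀ n z, 0 ≤ V n z := fun n z => mul_nonneg hC₀ ((hω n z).nonneg _ _)
  set U : ℕ → Circle → ℝ≥0∞ := fun n z => ENNReal.ofReal (V n z ^ (1 / s)) with hU
  have hUm : ∀ n, Measurable (U n) := fun n =>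
    (((hωm n _ _).const_mul C₀).pow_const _).ennreal_ofReal
  refine ⟨fun z => liminf (fun n => U n z) atTop, Measurable.liminf hUm,
    eLpNorm_liminf_le hq0 hUm fun n => ?_, fun z K N hN => ?_⟩
  · have h1 : eLpNorm (U n) q circleMeasure ^ s ≤
        ENNReal.ofReal (((C₀ * B) ^ (1 / s) * (A * D (-(n : ℤ)) n ^ (1 / P))) ^ s) := by
      have h2 := eLpNorm_enorm_rpow (μ := circleMeasure) (p := q / ENNReal.ofReal s) (U n) hs0
      rw [hqs] at h2
      rw [← h2]
      have h3 : (fun z => ‖U n z‖ₑ ^ s) = fun z => ‖(C₀ • fun z => ω n z (-(n : ℤ)) n) z‖ₑ := by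
        funext z
        have := hV0 n z
        rw [enorm_eq_self, ENNReal.ofReal_rpow_of_nonneg (by positivity) hs0.le,
          ← Real.rpow_mul this, one_div_mul_cancel hs0.ne', Real.rpow_one, Pi.smul_apply,
          smul_eq_mul, Real.enorm_eq_ofReal this]
      have hDn := hD0 (-(n : ℤ)) n
      rw [h3, eLpNorm_enorm, eLpNorm_const_smul, Real.enorm_eq_ofReal hC₀,
        Real.mul_rpow (by positivity) (by positivity), ← Real.rpow_mul (by positivity),
        one_div_mul_cancel hs0.ne', Real.rpow_one, ← hrpow _ hDn, mul_assoc,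
        ENNReal.ofReal_mul hC₀]
      gcongr
      exact hωn n
    have hDn := hD0 (-(n : ℤ)) n
    rw [← ENNReal.ofReal_rpow_of_nonneg (by positivity) hs0.le,
      ENNReal.rpow_le_rpow_iff hs0, ← mul_assoc, ENNReal.ofReal_mul (by positivity)] at h1
    refine h1.trans ?_
    exact mul_le_mul_right (sum_norm_coeff_rpow_le hpz hptop hF _) _
  · set g : ℝ≥0∞ → ℝ≥0∞ := fun x => (C.toNNReal * (x + x ^ s)) ^ s with hg
    have hgm : Monotone g := fun x y hxy => by
      simp only [hg]
      gcongr
    have hgc : Continuous g := by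
      refine ENNReal.continuous_rpow_const.comp ?_
      refine (ENNReal.continuous_const_mul ENNReal.coe_ne_top).comp ?_
      exact continuous_id.add ENNReal.continuous_rpow_const
    change _ ≤ g _
    rw [hgm.map_liminf_of_continuousAt _ hgc.continuousAt]
    refine le_liminf_of_le (by isBoundedDefault) ?_
    filter_upwards [eventually_ge_atTop (max (-(N 0 + 1)).toNat (N (Fin.last K) + 1).toNat)]
      with n hn
    rw [max_le_iff, Int.toNat_le, Int.toNat_le] at hn
    have hlow : ∀ j, -(n : ℤ) ≤ N j + 1 := fun j => by
      have := hN.monotone (Fin.zero_le j)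
      omega
    have hupp : ∀ j, N j + 1 ≤ n := fun j => by
      have := hN.monotone (Fin.le_last j)
      omega
    have hctl : IsControl fun a b => C₀ * ω n z a b :=
      ⟨fun a b => mul_nonneg hC₀ ((hω n z).nonneg _ _), fun a b c h1 h2 => by
        rw [← mul_add]
        exact mul_le_mul_of_nonneg_left ((hω n z).superadd a b c h1 h2) hC₀⟩
    have hSω : ∀ a b, -(n : ℤ) ≤ a → a ≤ b → b ≤ n →
        ‖trigSum (coeff F) (Finset.Ico a b) z‖ ≤ (C₀ * ω n z a b) ^ (1 / s) := by
      intro a b h1 h2 h3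
      have h4 := hωS n z a b h1 h2 h3
      rw [one_div]
      exact (Real.le_rpow_inv_iff_of_pos (norm_nonneg _) (hctl.nonneg a b) hs0).2 h4
    have hdist := hC F z _ _ _ hF hctl hSω
    -- With `w` the control of a step, `w ^ (1 / s) + w ≤ w ^ (1 / s) * (1 + V ^ (1 - 1 / s))`.
    have hterm : ∀ j : Fin K, logDist F z (N j.castSucc) (N j.succ) ^ s ≤
        (C * (1 + V n z ^ (1 - 1 / s))) ^ s * (C₀ * ω n z (N j.castSucc + 1) (N j.succ + 1)) := by
      intro j
      have hj : N j.castSucc < N j.succ := hN j.castSucc_lt_succ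
      have h1 := hdist (N j.castSucc + 1) (N j.succ + 1) (hlow _) (by omega) (hupp _)
      rw [add_sub_cancel_right] at h1
      set w := C₀ * ω n z (N j.castSucc + 1) (N j.succ + 1) with hw
      have hw0 : 0 ≤ w := hctl.nonneg _ _
      have hwV : w ≤ V n z := hctl.mono (hlow _) (by omega) (hupp _)
      have hV0' := hV0 n z
      have h1s : 0 ≤ 1 - 1 / s := by
        have := (div_le_one hs0).2 hs1.le
        linarith
      have h2 : w ≤ w ^ (1 / s) * V n z ^ (1 - 1 / s) := by
        calc w = w ^ (1 / s) * w ^ (1 - 1 / s) := by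
              rw [← Real.rpow_add_of_nonneg hw0 (by positivity) h1s, add_sub_cancel, Real.rpow_one]
          _ ≤ _ := by gcongr
      calc logDist F z (N j.castSucc) (N j.succ) ^ s
          ≤ (C * (1 + V n z ^ (1 - 1 / s)) * w ^ (1 / s)) ^ s := by
            refine Real.rpow_le_rpow (logDist_nonneg _ _ _ _) (h1.trans ?_) hs0.le
            rw [mul_assoc]
            gcongr
            linarith
        _ = _ := by
            rw [Real.mul_rpow (by positivity) (by positivity), ← Real.rpow_mul hw0,
              one_div_mul_cancel hs0.ne', Real.rpow_one]
    have hsum : ∑ j : Fin K, logDist F z (N j.castSucc) (N j.succ) ^ s ≤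
        (C * (V n z ^ (1 / s) + V n z)) ^ s := by
      have hV0' := hV0 n z
      have h1s : 0 ≤ 1 - 1 / s := by
        have := (div_le_one hs0).2 hs1.le
        linarith
      refine (Finset.sum_le_sum fun j _ => hterm j).trans ?_
      rw [← Finset.mul_sum]
      have h1 := hctl.sum_le (N := fun j => N j + 1) (fun i j hij => by
        have := hN.monotone hij
        dsimp only
        omega) hlow hupp
      calc _ ≤ (C * (1 + V n z ^ (1 - 1 / s))) ^ s * V n z := by gcongr
        _ = (C * (1 + V n z ^ (1 - 1 / s)) * V n z ^ (1 / s)) ^ s := by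
            rw [Real.mul_rpow (y := V n z ^ (1 / s)) (by positivity) (by positivity),
              ← Real.rpow_mul hV0',
              one_div_mul_cancel hs0.ne', Real.rpow_one]
        _ = (C * (V n z ^ (1 / s) + V n z)) ^ s := by
            rw [mul_assoc, add_mul, ← Real.rpow_add_of_nonneg hV0' h1s (by positivity),
              sub_add_cancel, Real.rpow_one, one_mul]
    have hV0' := hV0 n z
    have hgU : g (U n z) = ENNReal.ofReal ((C * (V n z ^ (1 / s) + V n z)) ^ s) := by
      simp only [hg, hU]
      rw [ENNReal.ofReal_rpow_of_nonneg (by positivity) hs0.le, ← Real.rpow_mul hV0',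
        one_div_mul_cancel hs0.ne', Real.rpow_one, ← ENNReal.ofReal_add (by positivity) hV0',
        ← ENNReal.ofReal_rpow_of_nonneg (by positivity) hs0.le, ENNReal.ofReal_mul (by positivity)]
      rfl
    rw [Function.comp_apply, hgU]
    refine le_trans (le_of_eq ?_) (ENNReal.ofReal_le_ofReal hsum)
    rw [varSum, ENNReal.ofReal_sum_of_nonneg fun _ _ => Real.rpow_nonneg (logDist_nonneg _ _ _ _) _]
    exact Finset.sum_congr rfl fun j _ =>
      ENNReal.ofReal_rpow_of_nonneg (logDist_nonneg _ _ _ _) hs0.le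

/-! ### Existence of the curve -/

theorem exists_cons_strictMono (δ : ℤ → ℤ → ℝ) (s : ℝ) {K : ℕ} {N : Fin (K + 1) → ℤ}
    (hN : StrictMono N) {x : ℤ} (hx : x < N 0) :
    ∃ N' : Fin (K + 1 + 1) → ℤ, StrictMono N' ∧ N' 0 = x ∧
      varSum δ s N' = ENNReal.ofReal (δ x (N 0)) ^ s + varSum δ s N := by
  refine ⟨Fin.cons x N, ?_, rfl, ?_⟩
  · rw [Fin.strictMono_iff_lt_succ]
    intro i
    refine Fin.cases ?_ (fun i => ?_) i
    · simpa using hx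
    · rw [Fin.cons_succ, ← Fin.succ_castSucc, Fin.cons_succ]
      exact hN i.castSucc_lt_succ
  · rw [varSum, Fin.sum_univ_succ]
    rfl

/-- Finite variation forces the increments near `-∞` to be uniformly small. -/
theorem exists_forall_le_of_varSum_le {δ : ℤ → ℤ → ℝ} {s : ℝ} (hs : 0 < s) (hδ : ∀ a, δ a a = 0)
    {R : ℝ≥0∞} (hR : R ≠ ∞)
    (h : ∀ (K : ℕ) (N : Fin (K + 1) → ℤ), StrictMono N → varSum δ s N ≤ R) {ε : ℝ} (hε : 0 < ε) :
    ∃ M₀ : ℤ, ∀ a b, a ≤ b → b ≤ M₀ → δ a b ≤ ε := by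
  by_contra! hcon
  have hε' : ENNReal.ofReal ε ^ s ≠ 0 := by
    simp only [Ne, ENNReal.rpow_eq_zero_iff, ENNReal.ofReal_eq_zero, not_or]
    constructor
    · rintro ⟨h1, -⟩
      linarith
    · simp
  have claim : ∀ k : ℕ, ∃ (K : ℕ) (N : Fin (K + 1) → ℤ), StrictMono N ∧
      k * ENNReal.ofReal ε ^ s ≤ varSum δ s N := by
    intro k
    induction k with
    | zero => exact ⟨0, fun _ => 0, fun i j hij => by omega, by simp⟩
    | succ k ih =>
      obtain ⟨K, N, hN, hk⟩ := ih
      obtain ⟨a, b, hab, hb, hd⟩ := hcon (N 0 - 1)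
      have hab' : a < b := hab.lt_of_ne fun h => by
        rw [h, hδ] at hd
        linarith
      obtain ⟨N₁, hN₁, h0, h1⟩ := exists_cons_strictMono δ s hN (x := b) (by omega)
      obtain ⟨N₂, hN₂, -, h2⟩ := exists_cons_strictMono δ s hN₁ (x := a) (by omega)
      refine ⟨_, N₂, hN₂, ?_⟩
      rw [h2, h1, h0]
      push_cast
      rw [add_mul, one_mul, add_comm]
      refine add_le_add ?_ (hk.trans le_add_self)
      gcongr
  obtain ⟨k, hk⟩ := ENNReal.exists_nat_mul_gt hε' hR
  obtain ⟨K, N, hN, hle⟩ := claim k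
  exact absurd (hle.trans (h K N hN)) (not_le.2 hk)

/-- If the increments near `-∞` are uniformly small, the products from `-M` to `N` form a Cauchy
sequence as `M → ∞`. -/
theorem tendsto_curve {F : ℤ → ℂ} {z : Circle}
    (h : ∀ ε : ℝ, 0 < ε → ∃ M₀ : ℤ, ∀ a b, a ≤ b → b ≤ M₀ → logDist F z a b ≤ ε) (N : ℤ) :
    Tendsto (fun M : ℕ => transferProd F (-(M : ℤ)) N z) atTop (𝓝 (curve F z N)) := by
  apply tendsto_nhds_limUnder
  set Φ := Matrix.toEuclideanCLM (n := Fin 2) (𝕜 := ℂ) with hΦ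
  set Y : ℕ → (EuclideanSpace ℂ (Fin 2) →L[ℂ] EuclideanSpace ℂ (Fin 2)) :=
    fun M => Φ (transferProd F (-(M : ℤ)) N z) with hY
  have hstep : ∀ ε : ℝ, 0 < ε → ∃ n : ℕ, ∀ m m' : ℕ, n ≤ m → m ≤ m' →
      ‖Y m' - Y m‖ ≤ ε * ‖Y m‖ := by
    intro ε hε
    obtain ⟨M₀, hM₀⟩ := h (Real.log (1 + ε)) (Real.log_pos (by linarith))
    refine ⟨max (-M₀).toNat (-N).toNat, fun m m' hm hm' => ?_⟩
    rw [max_le_iff, Int.toNat_le, Int.toNat_le] at hm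
    have h1 := hM₀ (-(m' : ℤ) - 1) (-(m : ℤ) - 1) (by omega) (by omega)
    rw [logDist, Real.log_le_log_iff
      (by linarith [opNorm_nonneg (transferProd F (-(m' : ℤ) - 1 + 1) (-(m : ℤ) - 1) z - 1)])
      (by linarith), sub_add_cancel, opNorm, map_sub, map_one] at h1
    have h2 := transferProd_mul F (a := -(m' : ℤ)) (b := -(m : ℤ) - 1) (c := N) (by omega)
      (by omega) z
    rw [sub_add_cancel] at h2
    have h3 : Y m' - Y m = (Φ (transferProd F (-(m' : ℤ)) (-(m : ℤ) - 1) z) - 1) * Y m := by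
      simp only [hY]
      rw [← h2, map_mul, sub_mul, one_mul]
    rw [h3]
    refine (norm_mul_le _ _).trans ?_
    gcongr
    linarith
  have hcauchy : CauchySeq Y := by
    obtain ⟨n₁, hn₁⟩ := hstep 1 one_pos
    have hbd : ∀ m, n₁ ≤ m → ‖Y m‖ ≤ 2 * ‖Y n₁‖ := fun m hm => by
      have h1 := hn₁ n₁ m le_rfl hm
      have h2 := norm_le_norm_add_norm_sub' (Y m) (Y n₁)
      linarith
    rw [Metric.cauchySeq_iff']
    intro ε hε
    obtain ⟨n₂, hn₂⟩ := hstep (ε / (2 * ‖Y n₁‖ + 1)) (by positivity)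
    refine ⟨max n₁ n₂, fun m hm => ?_⟩
    rw [dist_eq_norm]
    refine (hn₂ _ m (le_max_right _ _) hm).trans_lt ?_
    have h1 := hbd (max n₁ n₂) (le_max_left _ _)
    rw [div_mul_eq_mul_div, div_lt_iff₀ (by positivity)]
    gcongr
    linarith
  obtain ⟨y, hy⟩ := cauchySeq_tendsto_of_complete hcauchy
  refine ⟨Φ.symm y, ?_⟩
  have h1 := (continuous_toEuclideanCLM_symm.tendsto y).comp hy
  refine h1.congr fun M => ?_
  exact Φ.symm_apply_apply _

theorem dist11_curve {F : ℤ → ℂ} (hF : ∀ n, ‖F n‖ < 1) {z : Circle}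
    (h : ∀ N, Tendsto (fun M : ℕ => transferProd F (-(M : ℤ)) N z) atTop (𝓝 (curve F z N)))
    {M N : ℤ} (hMN : M ≤ N) : dist11 (curve F z M) (curve F z N) = logDist F z M N := by
  have h1 : curve F z M * transferProd F (M + 1) N z = curve F z N := by
    refine tendsto_nhds_unique ?_ (h N)
    refine ((h M).mul_const _).congr' ?_
    filter_upwards [eventually_ge_atTop (-M).toNat] with k hk
    rw [Int.toNat_le] at hk
    exact transferProd_mul F (by omega) hMN z
  have h2 : curve F z M ∈ SU11 := isClosed_SU11.mem_of_tendsto (h M)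
    (Eventually.of_forall fun k => transferProd_mem_SU11 hF _ _ z)
  rw [dist11, logDist, ← h1, Matrix.nonsing_inv_mul_cancel_left _ _ (isUnit_det_of_mem_SU11 h2)]

/-! ### Comparison and measurability of variations -/

theorem variation_le_of_varSum_le {γ : ℤ → Matrix (Fin 2) (Fin 2) ℂ} {δ : ℤ → ℤ → ℝ}
    (hγ : ∀ M N, M ≤ N → dist11 (γ M) (γ N) = δ M N) {s : ℝ} (hs : 0 < s) {b : ℝ≥0∞}
    (h : ∀ (K : ℕ) (N : Fin (K + 1) → ℤ), StrictMono N → varSum δ s N ≤ b ^ s) :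
    variation (ENNReal.ofReal s) γ ≤ b := by
  rw [variation, if_neg ENNReal.ofReal_ne_top, ENNReal.toReal_ofReal hs.le]
  refine iSup_le fun K => iSup_le fun N => iSup_le fun hN => ?_
  rw [one_div, ENNReal.rpow_inv_le_iff hs]
  refine le_trans (le_of_eq ?_) (h K N hN)
  exact Finset.sum_congr rfl fun j _ => by rw [hγ _ _ (hN j.castSucc_lt_succ).le]

theorem variation_anti {r s : ℝ≥0∞} (hs0 : s ≠ 0) (hs : s ≠ ∞) (hsr : s ≤ r)
    (γ : ℤ → Matrix (Fin 2) (Fin 2) ℂ) : variation r γ ≤ variation s γ := by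
  have hs' : 0 < s.toReal := ENNReal.toReal_pos hs0 hs
  have hsum : ∀ (K : ℕ) (N : Fin (K + 1) → ℤ), StrictMono N →
      ∑ j : Fin K, ENNReal.ofReal (dist11 (γ (N j.castSucc)) (γ (N j.succ))) ^ s.toReal ≤
        variation s γ ^ s.toReal := fun K N hN => by
    rw [← ENNReal.rpow_inv_le_iff hs', ← one_div]
    rw [variation, if_neg hs]
    exact le_iSup_of_le K (le_iSup_of_le N (le_iSup_of_le hN le_rfl))
  have hterm : ∀ (K : ℕ) (N : Fin (K + 1) → ℤ), StrictMono N → ∀ j : Fin K,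
      ENNReal.ofReal (dist11 (γ (N j.castSucc)) (γ (N j.succ))) ≤ variation s γ :=
    fun K N hN j => by
      rw [← ENNReal.rpow_le_rpow_iff hs']
      exact (Finset.single_le_sum (f := fun j : Fin K =>
        ENNReal.ofReal (dist11 (γ (N j.castSucc)) (γ (N j.succ))) ^ s.toReal)
        (fun _ _ => zero_le) (Finset.mem_univ j)).trans (hsum K N hN)
  by_cases hr : r = ∞
  · rw [variation, if_pos hr]
    exact iSup_le fun K => iSup_le fun N => iSup_le fun hN => iSup_le fun j => hterm K N hN j
  · have hsr' : s.toReal ≤ r.toReal := ENNReal.toReal_mono hr hsr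
    have hr' : 0 < r.toReal := hs'.trans_le hsr'
    conv_lhs => rw [variation, if_neg hr]
    refine iSup_le fun K => iSup_le fun N => iSup_le fun hN => ?_
    rw [one_div, ENNReal.rpow_inv_le_iff hr']
    have hadd : ∀ x : ℝ≥0∞, x ^ r.toReal = x ^ s.toReal * x ^ (r.toReal - s.toReal) := fun x => by
      rw [← ENNReal.rpow_add_of_nonneg _ _ hs'.le (by linarith), add_sub_cancel]
    calc _ ≤ ∑ j : Fin K, ENNReal.ofReal (dist11 (γ (N j.castSucc)) (γ (N j.succ))) ^ s.toReal *
              variation s γ ^ (r.toReal - s.toReal) := by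
            refine Finset.sum_le_sum fun j _ => ?_
            rw [hadd]
            have : 0 ≤ r.toReal - s.toReal := by linarith
            gcongr
            exact hterm K N hN j
      _ ≤ _ := by
            rw [← Finset.sum_mul, hadd]
            gcongr
            exact hsum K N hN

theorem continuous_logDist (F : ℤ → ℂ) (M N : ℤ) : Continuous fun z => logDist F z M N := by
  unfold logDist
  refine Continuous.log ?_ fun z =>
    (by linarith [opNorm_nonneg (transferProd F (M + 1) N z - 1)] :
      0 < 1 + opNorm (transferProd F (M + 1) N z - 1)).ne'
  exact continuous_const.add
    (continuous_opNorm.comp ((continuous_transferProd F _ _).sub continuous_const))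

theorem aemeasurable_curveVar {F : ℤ → ℂ} (hF : ∀ n, ‖F n‖ < 1)
    (h : ∀ᵐ z ∂circleMeasure, ∀ N,
      Tendsto (fun M : ℕ => transferProd F (-(M : ℤ)) N z) atTop (𝓝 (curve F z N))) (r : ℝ≥0∞) :
    AEMeasurable (curveVar r F) circleMeasure := by
  have hm : ∀ M N : ℤ, Measurable fun z => ENNReal.ofReal (logDist F z M N) := fun M N =>
    (continuous_logDist F M N).measurable.ennreal_ofReal
  by_cases hr : r = ∞
  · refine ⟨fun z => ⨆ (K : ℕ) (N : Fin (K + 1) → ℤ) (_ : StrictMono N) (j : Fin K),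
      ENNReal.ofReal (logDist F z (N j.castSucc) (N j.succ)), ?_, ?_⟩
    · exact Measurable.iSup fun K => Measurable.iSup fun N => Measurable.iSup fun _ =>
        Measurable.iSup fun j => hm _ _
    · filter_upwards [h] with z hz
      rw [curveVar, variation, if_pos hr]
      refine iSup_congr fun K => iSup_congr fun N => iSup_congr fun hN => iSup_congr fun j => ?_
      rw [dist11_curve hF hz (hN j.castSucc_lt_succ).le]
  · refine ⟨fun z => ⨆ (K : ℕ) (N : Fin (K + 1) → ℤ) (_ : StrictMono N),
      (∑ j : Fin K, ENNReal.ofReal (logDist F z (N j.castSucc) (N j.succ)) ^ r.toReal) ^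
        (1 / r.toReal), ?_, ?_⟩
    · exact Measurable.iSup fun K => Measurable.iSup fun N => Measurable.iSup fun _ =>
        (Finset.measurable_fun_sum _ fun j _ => (hm _ _).pow_const _).pow_const _
    · filter_upwards [h] with z hz
      rw [curveVar, variation, if_neg hr]
      refine iSup_congr fun K => iSup_congr fun N => iSup_congr fun hN => ?_
      refine congrArg (· ^ (1 / r.toReal)) (Finset.sum_congr rfl fun j _ => ?_)
      rw [dist11_curve hF hz (hN j.castSucc_lt_succ).le]

/-! ### The variational inequality -/

theorem logNorm_lt_top {p : ℝ≥0∞} (hp0 : p ≠ 0) (hp : p ≠ ∞) {F : ℤ → ℂ} (hF : IsPotential p F) :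
    logNorm p F < ∞ := by
  obtain ⟨hmem, hlt⟩ := hF
  have hp' : 0 < p.toReal := ENNReal.toReal_pos hp0 hp
  have hsum : Summable fun n => ‖F n‖ ^ p.toReal := hmem.summable hp'
  have h0 : Tendsto (fun n => ‖F n‖) cofinite (𝓝 0) := by
    have h1 := (hsum.tendsto_cofinite_zero).rpow_const (p := 1 / p.toReal) (Or.inr (by positivity))
    rw [Real.zero_rpow (by positivity)] at h1
    refine h1.congr fun n => ?_
    rw [← Real.rpow_mul (norm_nonneg _), mul_one_div_cancel hp'.ne', Real.rpow_one]
  have hlog0 : ∀ n, 0 ≤ Real.log ((1 + ‖F n‖) / (1 - ‖F n‖)) := fun n => by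
    have h1 := norm_nonneg (F n)
    have h2 := hlt n
    apply Real.log_nonneg
    rw [one_le_div (by linarith)]
    linarith
  -- `log ((1 + x) / (1 - x)) ≤ 2 * x / (1 - x) ≤ 4 * x` for `x ≤ 1 / 2`.
  have hlog : ∀ᶠ n in cofinite, Real.log ((1 + ‖F n‖) / (1 - ‖F n‖)) ≤ 4 * ‖F n‖ := by
    filter_upwards [h0.eventually (eventually_le_nhds (show (0 : ℝ) < 1 / 2 by norm_num))] with n hn
    have h1 := norm_nonneg (F n)
    have h2 := hlt n
    refine (Real.log_le_sub_one_of_pos (div_pos (by linarith) (by linarith))).trans ?_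
    rw [sub_le_iff_le_add, div_le_iff₀ (by linarith)]
    nlinarith
  have hsum' : Summable fun n => Real.log ((1 + ‖F n‖) / (1 - ‖F n‖)) ^ p.toReal := by
    refine Summable.of_norm_bounded_eventually (hsum.mul_left (4 ^ p.toReal)) ?_
    filter_upwards [hlog] with n hn
    have := hlog0 n
    rw [Real.norm_of_nonneg (by positivity), ← Real.mul_rpow (by norm_num) (norm_nonneg _)]
    gcongr
  rw [logNorm, eLpNorm_lt_top_iff_lintegral_rpow_enorm_lt_top hp0 hp, lintegral_count]
  refine lt_of_le_of_lt (le_of_eq (tsum_congr fun n => ?_)) hsum'.tsum_ofReal_lt_top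
  rw [Real.enorm_eq_ofReal (hlog0 n), ENNReal.ofReal_rpow_of_nonneg (hlog0 n) hp'.le]

/-- The two regimes of the variation `v` in terms of the majorant `u`: linear as long as `v ≤ 1`,
and of degree `σ` beyond. -/
theorem le_or_le_rpow_of_le_add_rpow {C u v : ℝ≥0∞} {σ : ℝ} (hC : 1 ≤ C) (hσ : 1 ≤ σ)
    (h : v ≤ C * (u + u ^ σ)) :
    (v ≤ 1 → v ≤ 2 * C * u) ∧ (1 < v → 1 ≤ 2 * C * u ∧ v ≤ (2 * C * u) ^ σ) := by
  have h2C : (1 : ℝ≥0∞) ≤ 2 * C := hC.trans (le_mul_of_one_le_left zero_le (by norm_num))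
  rcases le_total u 1 with hu | hu
  · have h1 : v ≤ 2 * C * u := by
      refine h.trans ?_
      have h2 : u ^ σ ≤ u := ENNReal.rpow_le_self_of_le_one hu hσ
      calc C * (u + u ^ σ) ≤ C * (u + u) := by gcongr
        _ = 2 * C * u := by ring
    exact ⟨fun _ => h1, fun hv => ⟨hv.le.trans h1,
      h1.trans (ENNReal.le_rpow_self_of_one_le (hv.le.trans h1) hσ)⟩⟩
  · have hw : 1 ≤ 2 * C * u := by
      calc (1 : ℝ≥0∞) = 1 * 1 := by simp
        _ ≤ 2 * C * u := by gcongr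
    refine ⟨fun hv => hv.trans hw, fun _ => ⟨hw, h.trans ?_⟩⟩
    have h2 : u ≤ u ^ σ := ENNReal.le_rpow_self_of_one_le hu hσ
    calc C * (u + u ^ σ) ≤ C * (u ^ σ + u ^ σ) := by gcongr
      _ = 2 * C * u ^ σ := by ring
      _ ≤ (2 * C) ^ σ * u ^ σ := by
          gcongr
          exact ENNReal.le_rpow_self_of_one_le h2C hσ
      _ = _ := (ENNReal.mul_rpow_of_nonneg _ _ (by linarith)).symm

theorem auxExponent_spec {p r : ℝ≥0∞} (hp2 : p < 2) (hr : p < r) :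
    p < auxExponent p r ∧ auxExponent p r < 2 ∧ auxExponent p r ≤ r := by
  rw [auxExponent]
  split_ifs with h
  · exact ⟨hr, h, le_rfl⟩
  · have hpt : p ≠ ∞ := (hp2.trans (by norm_num)).ne
    have h1 : (p + 2) / 2 < 2 := by
      rw [ENNReal.div_lt_iff (by simp) (by simp)]
      calc p + 2 < 2 + 2 := ENNReal.add_lt_add_right (by norm_num) hp2
        _ = 2 * 2 := by norm_num
    refine ⟨?_, h1, h1.le.trans (not_lt.1 h)⟩
    rw [ENNReal.lt_div_iff_mul_lt (by simp) (by simp), mul_two]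
    exact ENNReal.add_lt_add_left hpt hp2

end NLFT

theorem theorem1 (p r : ℝ≥0∞) (hp1 : 1 ≤ p) (hp2 : p < 2) (hr : p < r) :
    -- the curve and the norms below are well defined
    (∀ F : ℤ → ℂ, NLFT.IsPotential p F →
      (∀ᵐ z ∂NLFT.circleMeasure, ∀ N : ℤ,
        NLFT.curve F z N ∈ NLFT.SU11 ∧
        Tendsto (fun M : ℕ => NLFT.transferProd F (-(M : ℤ)) N z) atTop
          (𝓝 (NLFT.curve F z N))) ∧
      AEMeasurable (NLFT.curveVar r F) NLFT.circleMeasure ∧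
      NullMeasurableSet (NLFT.smallVarSet p r F) NLFT.circleMeasure ∧
      NLFT.logNorm p F < ∞) ∧
    -- the variational nonlinear Hausdorff-Young inequality
    ∃ C : ℝ≥0, ∀ F : ℤ → ℂ, NLFT.IsPotential p F →
      (r ≠ ∞ →
        eLpNorm (NLFT.curveVar r F) (ENNReal.conjExponent p)
            (NLFT.circleMeasure.restrict (NLFT.smallVarSet p r F)) +
          (eLpNorm (NLFT.curveVar r F) (ENNReal.conjExponent p / r)
            (NLFT.circleMeasure.restrict (NLFT.smallVarSet p r F)ᶜ)) ^ (1 / r.toReal)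
        ≤ C * NLFT.logNorm p F) ∧
      -- for `r = ∞`, the function `V_r ^ (1 / r)` in the second term is the constant `1`
      (r = ∞ →
        eLpNorm (NLFT.curveVar r F) (ENNReal.conjExponent p)
            (NLFT.circleMeasure.restrict (NLFT.smallVarSet p r F)) +
          eLpNorm (fun _ : Circle => (1 : ℝ≥0∞)) (ENNReal.conjExponent p)
            (NLFT.circleMeasure.restrict (NLFT.smallVarSet p r F)ᶜ)
        ≤ C * NLFT.logNorm p F) := by
  have hpt : p ≠ ∞ := (hp2.trans (by norm_num)).ne
  have hp0 : p ≠ 0 := (zero_lt_one.trans_le hp1).ne'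
  obtain ⟨hps, hs2, hsr⟩ := NLFT.auxExponent_spec hp2 hr
  set s := NLFT.auxExponent p r with hs
  have hst : s ≠ ∞ := (hs2.trans (by norm_num)).ne
  have hs0 : s ≠ 0 := (zero_le.trans_lt hps).ne'
  have hsR : ENNReal.ofReal s.toReal = s := ENNReal.ofReal_toReal hst
  have hpsR : p.toReal < s.toReal := (ENNReal.toReal_lt_toReal hpt hst).2 hps
  have hs2R : s.toReal < 2 := (ENNReal.toReal_lt_toReal hst (by norm_num)).2 hs2
  have hs1R : 1 ≤ s.toReal := by
    rw [← ENNReal.toReal_one]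
    exact ENNReal.toReal_mono hst (hp1.trans hps.le)
  have hs0R : 0 < s.toReal := by linarith
  obtain ⟨C, A, hC1, hCA⟩ := NLFT.exists_logDist_majorant hp1 hp2 hpsR hs2R
  have hq0 : ENNReal.conjExponent p ≠ 0 := by simp [ENNReal.conjExponent]
  -- At almost every point the majorant is finite, hence so is the variation, and the limits exist.
  have hlim : ∀ F : ℤ → ℂ, NLFT.IsPotential p F → ∀ᵐ z ∂NLFT.circleMeasure, ∀ N : ℤ,
      Tendsto (fun M : ℕ => NLFT.transferProd F (-(M : ℤ)) N z) atTop
        (𝓝 (NLFT.curve F z N)) := by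
    intro F hF
    obtain ⟨U, hUm, hUn, hU⟩ := hCA F hF.2
    have hfin : eLpNorm U (ENNReal.conjExponent p) NLFT.circleMeasure < ∞ :=
      hUn.trans_lt (ENNReal.mul_lt_top ENNReal.coe_lt_top (NLFT.logNorm_lt_top hp0 hpt hF))
    have hae : ∀ᵐ z ∂NLFT.circleMeasure, U z < ∞ := by
      have h1 := (eLpNorm_le_eLpNorm_of_exponent_le (p := 1) (q := ENNReal.conjExponent p)
        (by simp [ENNReal.conjExponent]) hUm.aestronglyMeasurable).trans_lt hfin
      rw [eLpNorm_one_eq_lintegral_enorm] at h1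
      exact ae_lt_top hUm h1.ne
    filter_upwards [hae] with z hz
    refine NLFT.tendsto_curve fun ε hε =>
      NLFT.exists_forall_le_of_varSum_le hs0R (fun a => ?_) ?_ (hU z) hε
    · rw [NLFT.logDist, NLFT.transferProd_of_lt F (by omega), sub_self]
      simp [NLFT.opNorm]
    · have h1 : U z ^ s.toReal ≠ ∞ := ENNReal.rpow_ne_top_of_nonneg hs0R.le hz.ne
      exact ENNReal.rpow_ne_top_of_nonneg hs0R.le
        (ENNReal.mul_ne_top ENNReal.coe_ne_top (ENNReal.add_ne_top.2 ⟨hz.ne, h1⟩))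
  have hnull : ∀ F : ℤ → ℂ, NLFT.IsPotential p F →
      NullMeasurableSet (NLFT.smallVarSet p r F) NLFT.circleMeasure := fun F hF =>
    nullMeasurableSet_le (NLFT.aemeasurable_curveVar hF.2 (hlim F hF) s) aemeasurable_const
  refine ⟨fun F hF => ⟨?_, NLFT.aemeasurable_curveVar hF.2 (hlim F hF) r, hnull F hF,
    NLFT.logNorm_lt_top hp0 hpt hF⟩, 2 * (2 * C * A), fun F hF => ?_⟩
  · filter_upwards [hlim F hF] with z hz N
    exact ⟨NLFT.isClosed_SU11.mem_of_tendsto (hz N)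
      (Eventually.of_forall fun k => NLFT.transferProd_mem_SU11 hF.2 _ _ z), hz N⟩
  obtain ⟨U, hUm, hUn, hU⟩ := hCA F hF.2
  set w : Circle → ℝ≥0∞ := fun z => 2 * C * U z with hw
  have hwn : eLpNorm w (ENNReal.conjExponent p) NLFT.circleMeasure ≤
      2 * C * A * NLFT.logNorm p F := by
    rw [mul_assoc _ (A : ℝ≥0∞)]
    refine le_trans ?_ (mul_le_mul_right hUn _)
    exact eLpNorm_le_mul_eLpNorm_of_ae_le_mul'' _ hUm.aestronglyMeasurable
      (ae_of_all _ fun z => le_rfl)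
  have hpoint : ∀ᵐ z ∂NLFT.circleMeasure,
      (NLFT.curveVar s F z ≤ 1 → NLFT.curveVar s F z ≤ w z) ∧
      (1 < NLFT.curveVar s F z → 1 ≤ w z ∧ NLFT.curveVar s F z ≤ w z ^ s.toReal) := by
    filter_upwards [hlim F hF] with z hz
    refine NLFT.le_or_le_rpow_of_le_add_rpow (by exact_mod_cast hC1) hs1R ?_
    have := NLFT.variation_le_of_varSum_le
      (fun M N hMN => NLFT.dist11_curve hF.2 hz hMN) hs0R (hU z)
    rwa [hsR] at this
  have hanti : ∀ z, NLFT.curveVar r F z ≤ NLFT.curveVar s F z := fun z =>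
    NLFT.variation_anti hs0 hst hsr _
  have hfirst : eLpNorm (NLFT.curveVar r F) (ENNReal.conjExponent p)
      (NLFT.circleMeasure.restrict (NLFT.smallVarSet p r F)) ≤ 2 * C * A * NLFT.logNorm p F := by
    refine (eLpNorm_mono_enorm_ae (g := w) ?_).trans
      ((eLpNorm_mono_measure _ Measure.restrict_le_self).trans hwn)
    filter_upwards [ae_restrict_mem₀ (hnull F hF), ae_restrict_of_ae hpoint] with z hz hzp
    exact (hanti z).trans (hzp.1 hz)
  have hcompl : ∀ᵐ z ∂NLFT.circleMeasure.restrict (NLFT.smallVarSet p r F)ᶜ,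
      1 ≤ w z ∧ NLFT.curveVar s F z ≤ w z ^ s.toReal := by
    filter_upwards [ae_restrict_mem₀ (hnull F hF).compl, ae_restrict_of_ae hpoint] with z hz hzp
    exact hzp.2 (not_le.1 hz)
  have hwc : eLpNorm w (ENNReal.conjExponent p)
      (NLFT.circleMeasure.restrict (NLFT.smallVarSet p r F)ᶜ) ≤ 2 * C * A * NLFT.logNorm p F :=
    (eLpNorm_mono_measure _ Measure.restrict_le_self).trans hwn
  have htotal : ∀ a b : ℝ≥0∞, a ≤ 2 * C * A * NLFT.logNorm p F →
      b ≤ 2 * C * A * NLFT.logNorm p F →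
      a + b ≤ ((2 * (2 * C * A) : ℝ≥0) : ℝ≥0∞) * NLFT.logNorm p F := fun a b ha hb => by
    refine (add_le_add ha hb).trans (le_of_eq ?_)
    push_cast
    ring
  refine ⟨fun hrt => htotal _ _ hfirst ?_, fun hrt => htotal _ _ hfirst ?_⟩
  · have hr0 : r ≠ 0 := (zero_le.trans_lt hr).ne'
    have hr0R : 0 < r.toReal := ENNReal.toReal_pos hr0 hrt
    have hsrR : s.toReal ≤ r.toReal := ENNReal.toReal_mono hrt hsr
    have h1 := eLpNorm_enorm_rpow (p := ENNReal.conjExponent p / r)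
      (μ := NLFT.circleMeasure.restrict (NLFT.smallVarSet p r F)ᶜ) w hr0R
    rw [ENNReal.ofReal_toReal hrt, ENNReal.div_mul_cancel hr0 hrt] at h1
    rw [one_div, ENNReal.rpow_inv_le_iff hr0R]
    refine le_trans ?_ (h1.le.trans (ENNReal.rpow_le_rpow hwc hr0R.le))
    refine eLpNorm_mono_enorm_ae ?_
    filter_upwards [hcompl] with z hz
    simp only [enorm_eq_self]
    exact ((hanti z).trans hz.2).trans (ENNReal.rpow_le_rpow_of_exponent_le hz.1 hsrR)
  · refine (eLpNorm_mono_enorm_ae (g := w) ?_).trans hwc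
    filter_upwards [hcompl] with z hz
    exact hz.1
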